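/- Write $\mathbb R^+=[0,\infty)$. For a positive, continuous function $\omega$ on $\mathbb R^+$ let - $L^1(\omega)$ be the space of (classes of) complex-valued measurable functions $f$ on $\mathbb R^+$ with $\|f\|=\int_0^\infty |f(t)|\,\omega(t)\,dt<\infty$; - $L^\infty(1/\omega)$ be the space of (classes of) complex-valued measurable functions $h$ on $\mathbb R^+$ with $\|h\|=\operatorname{ess\,sup}_{t}|h(t)|/\omega(t)<\infty$, identified with the dual of $L^1(\omega)$ through $\langle f,h\rangle=\int_0^\infty f(t)h(t)\,dt$; - $C_0(\omega)$ be the closed subspace of $L^\infty(1/\omega)$ of continuous functions $g$ such that $g/\omega$ vanishes at infinity; - $M(\omega)=M(\mathbb R^+,\omega)$ be the space of locally finite complex Borel measures $\mu$ on $\mathbb R^+$ with $\|\mu\|=\int_{\mathbb R^+}\omega\,d|\mu|<\infty$, identified with the dual of $C_0(\omega)$ through $\langle g,\mu\rangle=\int_{\mathbb R^+} g\,d\mu$. The space $L^1(\omega)$ is regarded as a subspace of $M(\omega)$ by identifying $f$ with the measure $f(t)\,dt$. Let $\psi$ be a non-negative, measurable function on $[0,1]$, let $\omega_1$ and $\omega_2$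 be positive, continuous functions on $\mathbb R^+$, and assume that condition (C) is satisfied: there is a constant $C$ such that $$\int_0^1\omega_2(s/t)\,\frac{\psi(t)}{t}\,dt\le C\,\omega_1(s)\qquad\text{for every } s\in\mathbb R^+ .$$ Then $(U_\psi f)(x)=\int_0^1 f(tx)\,\psi(t)\,dt$ (the integral exists for almost every $x$) defines a bounded linear operator $U_\psi:L^1(\omega_1)\to L^1(\omega_2)$. Its adjoint is the bounded operator $U_\psi^*:L^\infty(1/\omega_2)\to L^\infty(1/\omega_1)$ given by $\langle f,U_\psi^*h\rangle=\langle U_\psi f,h\rangle$. It maps $C_0(\omega_2)$ into $C_0(\omega_1)$; let $V_\psi:C_0(\omega_2)\to C_0(\omega_1)$ be its restriction, which is a bounded operator. The adjoint $\overline U_\psi=V_\psi^*$, that is, the unique bounded operator $\overline U_\psi:M(\omega_1)\to M(\omega_2)$ with $\langle g,\overline U_\psi\mu\rangle=\langle V_\psi g,\mu\rangle$ for all $g\in C_0(\omega_2)$ and $\mu\in M(\omega_1)$, is an extension of $U_\psi$: $\overline U_\psi f=U_\psi f$ for every $f\in L^1(\omega_1)$. -/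

import Mathlib

open MeasureTheory Set
open scoped NNReal ENNReal

noncomputable section

namespace HardyCesaro

/-- Lebesgue measure on the half-line `[0, ∞)`. -/
def leb : Measure ℝ≥0 := Measure.comap ((↑) : ℝ≥0 → ℝ) volume

/-- A weight: a positive, continuous function on `[0, ∞)`. -/
structure Weight where
  toFun : ℝ≥0 → ℝ≥0
  continuous_toFun : Continuous toFun
  pos : ∀ t, 0 < toFun t

instance : CoeFun Weight (fun _ => ℝ≥0 → ℝ≥0) := ⟨Weight.toFun⟩

/-! ### The space `L¹(ω)` -/

/-- The weighted space `L¹(ω)`: classes of measurable functions `f` with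
`‖f‖ = ∫ |f(t)| ω(t) dt < ∞`, that is, the `L¹` space of the measure `ω(t) dt`, which has the same
null sets as Lebesgue measure since `ω > 0`. -/
abbrev WL1 (ω : Weight) : Type := Lp ℂ 1 (leb.withDensity fun t => (ω t : ℝ≥0∞))

/-! ### The space `L^∞(1/ω)` -/

lemma Weight.measurable (ω : Weight) : Measurable ω := ω.continuous_toFun.measurable

lemma Weight.ne_zero (ω : Weight) (t : ℝ≥0) : ((ω t : ℝ) : ℂ) ≠ 0 := by
  have := ω.pos t
  exact_mod_cast this.ne'

lemma Weight.aesm_div (ω : Weight) {h : ℝ≥0 → ℂ} (hh : AEStronglyMeasurable h leb) :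
    AEStronglyMeasurable (fun t => h t / ((ω t : ℝ) : ℂ)) leb := by
  have h1 : Measurable fun t => ((ω t : ℝ) : ℂ) :=
    Complex.measurable_ofReal.comp (measurable_coe_nnreal_real.comp ω.measurable)
  exact (hh.aemeasurable.div h1.aemeasurable).aestronglyMeasurable

/-- `ess sup |h(t)| / ω(t)` as an extended non-negative number. -/
def linfENorm (ω : Weight) (h : ℝ≥0 →ₘ[leb] ℂ) : ℝ≥0∞ :=
  eLpNorm (fun t => h t / ((ω t : ℝ) : ℂ)) ∞ leb

lemma linfENorm_add_le (ω : Weight) (h k : ℝ≥0 →ₘ[leb] ℂ) :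
    linfENorm ω (h + k) ≤ linfENorm ω h + linfENorm ω k := by
  unfold linfENorm
  refine le_trans (le_of_eq ?_) (eLpNorm_add_le (ω.aesm_div h.aestronglyMeasurable)
    (ω.aesm_div k.aestronglyMeasurable) le_top)
  apply eLpNorm_congr_ae
  filter_upwards [AEEqFun.coeFn_add h k] with t ht
  simp [ht, add_div]

lemma linfENorm_smul (ω : Weight) (c : ℂ) (h : ℝ≥0 →ₘ[leb] ℂ) :
    linfENorm ω (c • h) = ‖c‖ₑ * linfENorm ω h := by
  unfold linfENorm
  rw [← eLpNorm_const_smul]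
  apply eLpNorm_congr_ae
  filter_upwards [AEEqFun.coeFn_smul c h] with t ht
  simp [ht, mul_div_assoc]

lemma linfENorm_eq_zero (ω : Weight) (h : ℝ≥0 →ₘ[leb] ℂ) : linfENorm ω h = 0 ↔ h = 0 := by
  unfold linfENorm
  rw [eLpNorm_eq_zero_iff (ω.aesm_div h.aestronglyMeasurable) (by simp)]
  constructor
  · intro hh
    apply AEEqFun.ext
    filter_upwards [hh, AEEqFun.coeFn_zero (α := ℝ≥0) (β := ℂ) (μ := leb)] with t ht h0
    rw [h0]
    simpa [(ω.pos t).ne'] using ht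
  · rintro rfl
    filter_upwards [AEEqFun.coeFn_zero (α := ℝ≥0) (β := ℂ) (μ := leb)] with t h0
    simp [h0]

/-- The classes `h` of measurable functions with `ess sup |h(t)| / ω(t) < ∞`. -/
def linfSubmodule (ω : Weight) : Submodule ℂ (ℝ≥0 →ₘ[leb] ℂ) where
  carrier := {h | linfENorm ω h < ∞}
  add_mem' {h k} hh hk := (linfENorm_add_le ω h k).trans_lt (ENNReal.add_lt_top.2 ⟨hh, hk⟩)
  zero_mem' := by
    change linfENorm ω 0 < ∞
    rw [(linfENorm_eq_zero ω 0).2 rfl]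
    exact ENNReal.zero_lt_top
  smul_mem' c h hh := by
    change linfENorm ω (c • h) < ∞
    rw [linfENorm_smul]
    exact ENNReal.mul_lt_top enorm_lt_top hh

/-- The weighted space `L^∞(1/ω)`, with the norm `ess sup |h(t)| / ω(t)`. -/
def WLinf (ω : Weight) : Type := linfSubmodule ω

instance (ω : Weight) : AddCommGroup (WLinf ω) := inferInstanceAs (AddCommGroup (linfSubmodule ω))
instance (ω : Weight) : Module ℂ (WLinf ω) := inferInstanceAs (Module ℂ (linfSubmodule ω))

/-- The class of functions underlying an element of `L^∞(1/ω)`. -/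
def WLinf.toClass {ω : Weight} (h : WLinf ω) : ℝ≥0 →ₘ[leb] ℂ := h.1

instance (ω : Weight) : Norm (WLinf ω) := ⟨fun h => (linfENorm ω h.toClass).toReal⟩

lemma WLinf.core (ω : Weight) : NormedSpace.Core ℂ (WLinf ω) where
  norm_nonneg _ := ENNReal.toReal_nonneg
  norm_smul c h := by
    change (linfENorm ω (c • h.toClass)).toReal = _ * (linfENorm ω h.toClass).toReal
    rw [linfENorm_smul]
    simp
  norm_triangle h k := by
    change (linfENorm ω (h.toClass + k.toClass)).toReal
      ≤ (linfENorm ω h.toClass).toReal + (linfENorm ω k.toClass).toReal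
    have hh : linfENorm ω h.toClass < ∞ := h.2
    have hk : linfENorm ω k.toClass < ∞ := k.2
    rw [← ENNReal.toReal_add hh.ne hk.ne]
    exact ENNReal.toReal_mono (ENNReal.add_lt_top.2 ⟨h.2, k.2⟩).ne (linfENorm_add_le ω _ _)
  norm_eq_zero_iff h := by
    change (linfENorm ω h.toClass).toReal = 0 ↔ _
    rw [ENNReal.toReal_eq_zero_iff, or_iff_left h.2.ne, linfENorm_eq_zero]
    exact ⟨fun h0 => Subtype.ext h0, fun h0 => by rw [h0]; rfl⟩

instance (ω : Weight) : NormedAddCommGroup (WLinf ω) := NormedAddCommGroup.ofCore (WLinf.core ω)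
instance (ω : Weight) : NormedSpace ℂ (WLinf ω) := NormedSpace.ofCore (WLinf.core ω)

/-- The duality `⟨f, h⟩ = ∫ f(t) h(t) dt` between `L¹(ω)` and `L^∞(1/ω)`. -/
def pairL {ω : Weight} (f : WL1 ω) (h : WLinf ω) : ℂ := ∫ t, f t * h.toClass t ∂leb

/-! ### The space `C₀(ω)` -/

/-- The continuous functions `g` such that `g/ω` vanishes at infinity. -/
def c0Submodule (ω : Weight) : Submodule ℂ C(ℝ≥0, ℂ) where
  carrier := {g | Filter.Tendsto (fun t => g t / ((ω t : ℝ) : ℂ)) (Filter.cocompact ℝ≥0) (nhds 0)}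
  add_mem' {g k} hg hk := by
    have := Filter.Tendsto.add hg hk
    simpa [add_div] using this
  zero_mem' := by simp
  smul_mem' c g hg := by
    have := Filter.Tendsto.const_mul c hg
    simpa [mul_div_assoc] using this

/-- The weighted space `C₀(ω)`, with the norm `sup |g(t)| / ω(t)` inherited from `L^∞(1/ω)`. -/
def WC0 (ω : Weight) : Type := c0Submodule ω

instance (ω : Weight) : AddCommGroup (WC0 ω) := inferInstanceAs (AddCommGroup (c0Submodule ω))
instance (ω : Weight) : Module ℂ (WC0 ω) := inferInstanceAs (Module ℂ (c0Submodule ω))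

instance (ω : Weight) : CoeFun (WC0 ω) (fun _ => ℝ≥0 → ℂ) := ⟨fun g => g.1⟩

/-- `g ↦ g/ω`, from `C₀(ω)` to the space of continuous functions vanishing at infinity. -/
def WC0.divWeight (ω : Weight) : WC0 ω →ₗ[ℂ] ZeroAtInftyContinuousMap ℝ≥0 ℂ where
  toFun g :=
    { toFun := fun t => g t / ((ω t : ℝ) : ℂ)
      continuous_toFun := by
        have h1 : Continuous fun t => ((ω t : ℝ) : ℂ) :=
          Complex.continuous_ofReal.comp (NNReal.continuous_coe.comp ω.continuous_toFun)
        exact g.1.continuous.div h1 ω.ne_zero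
      zero_at_infty' := g.2 }
  map_add' g k := by
    ext t
    exact add_div (g t) (k t) _
  map_smul' c g := by
    ext t
    exact mul_div_assoc c (g t) _

lemma WC0.divWeight_injective (ω : Weight) : Function.Injective (WC0.divWeight ω) := by
  intro g k hgk
  apply Subtype.ext
  ext t
  have : g t / ((ω t : ℝ) : ℂ) = k t / ((ω t : ℝ) : ℂ) := DFunLike.congr_fun hgk t
  exact (div_left_inj' (ω.ne_zero t)).1 this

instance (ω : Weight) : NormedAddCommGroup (WC0 ω) :=
  NormedAddCommGroup.induced (WC0 ω) (ZeroAtInftyContinuousMap ℝ≥0 ℂ) (WC0.divWeight ω)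
    (WC0.divWeight_injective ω)
instance (ω : Weight) : NormedSpace ℂ (WC0 ω) :=
  NormedSpace.induced ℂ (WC0 ω) (ZeroAtInftyContinuousMap ℝ≥0 ℂ) (WC0.divWeight ω)

/-- The inclusion of `C₀(ω)` in `L^∞(1/ω)`. -/
def WC0.toLinf {ω : Weight} (g : WC0 ω) : WLinf ω :=
  ⟨ContinuousMap.toAEEqFun leb g.1, by
    change linfENorm ω _ < ∞
    unfold linfENorm
    refine lt_of_le_of_lt ?_ (ENNReal.ofReal_lt_top (r := ‖WC0.divWeight ω g‖))
    rw [eLpNorm_exponent_top]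
    refine essSup_le_of_ae_le _ ?_
    filter_upwards [ContinuousMap.coeFn_toAEEqFun leb g.1] with t ht
    rw [ht, ← ofReal_norm]
    exact ENNReal.ofReal_le_ofReal
      (BoundedContinuousFunction.norm_coe_le_norm (WC0.divWeight ω g).toBCF t)⟩

/-! ### Locally finite complex Borel measures and the space `M(ω)` -/

/-- The locally finite complex Borel measures on `[0, ∞)`: complex-valued, countably additive
functions on the bounded Borel sets. (On all other sets they get the value `0` by convention.) -/
def locSubmodule : Submodule ℂ (Set ℝ≥0 → ℂ) where
  carrier := {μ | (∀ E, ¬(MeasurableSet E ∧ Bornology.IsBounded E) → μ E = 0) ∧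
    ∀ E : ℕ → Set ℝ≥0, (∀ n, MeasurableSet (E n)) → Pairwise (Function.onFun Disjoint E) →
      Bornology.IsBounded (⋃ n, E n) → HasSum (fun n => μ (E n)) (μ (⋃ n, E n))}
  add_mem' {μ ν} hμ hν :=
    ⟨fun E hE => by simp [hμ.1 E hE, hν.1 E hE],
      fun E h1 h2 h3 => (hμ.2 E h1 h2 h3).add (hν.2 E h1 h2 h3)⟩
  zero_mem' := ⟨fun _ _ => rfl, fun _ _ _ _ => hasSum_zero⟩
  smul_mem' c μ hμ :=
    ⟨fun E hE => by simp [hμ.1 E hE], fun E h1 h2 h3 => (hμ.2 E h1 h2 h3).mul_left c⟩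

/-- The type of locally finite complex Borel measures on `[0, ∞)`. -/
def LocMeasure : Type := locSubmodule

instance : AddCommGroup LocMeasure := inferInstanceAs (AddCommGroup locSubmodule)
instance : Module ℂ LocMeasure := inferInstanceAs (Module ℂ locSubmodule)

lemma LocMeasure.empty (μ : LocMeasure) : μ.1 ∅ = 0 := by
  have h := μ.2.2 (fun _ => ∅) (fun _ => MeasurableSet.empty)
    (fun _ _ _ => by simp [Function.onFun]) (by simp)
  have h2 := h.summable.tendsto_atTop_zero
  exact tendsto_nhds_unique tendsto_const_nhds h2

lemma isBounded_Ico (a b : ℝ≥0) : Bornology.IsBounded (Ico a b) :=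
  Metric.isBounded_Ico a b

open scoped Classical in
/-- The finite complex measure `E ↦ μ(E ∩ [n, n+1))`. -/
def LocMeasure.part (n : ℕ) (μ : LocMeasure) : ComplexMeasure ℝ≥0 where
  measureOf' E := if MeasurableSet E then μ.1 (E ∩ Ico (n : ℝ≥0) (n + 1)) else 0
  empty' := by simp [μ.empty]
  not_measurable' E hE := by simp [hE]
  m_iUnion' E hE hd := by
    simp only [hE, MeasurableSet.iUnion hE, if_true, iUnion_inter]
    refine μ.2.2 _ (fun i => (hE i).inter measurableSet_Ico)
      (fun i j hij => (hd hij).mono inter_subset_left inter_subset_left) ?_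
    exact (isBounded_Ico (n : ℝ≥0) (n + 1)).subset (iUnion_subset fun i => inter_subset_right)

/-- The total variation measure `|μ|`, glued from the total variations on the pieces `[n, n+1)`. -/
def LocMeasure.tv (μ : LocMeasure) : Measure ℝ≥0 := Measure.sum fun n => (μ.part n).variation

/-- The integral `∫ g dμ`, for a function `g` that is integrable with respect to `|μ|`: the
absolutely convergent sum of the integrals over the pieces `[n, n+1)`. -/
def LocMeasure.integral (μ : LocMeasure) (g : ℝ≥0 → ℂ) : ℂ :=
  ∑' n, VectorMeasure.integral (μ.part n) g (ContinuousLinearMap.mul ℝ ℂ)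

lemma LocMeasure.part_apply (n : ℕ) (μ : LocMeasure) {E : Set ℝ≥0} (hE : MeasurableSet E) :
    μ.part n E = μ.1 (E ∩ Ico (n : ℝ≥0) (n + 1)) := if_pos hE

lemma LocMeasure.part_add (n : ℕ) (μ ν : LocMeasure) : (μ + ν).part n = μ.part n + ν.part n := by
  ext E hE
  change (μ + ν).part n E = μ.part n E + ν.part n E
  simp only [LocMeasure.part_apply _ _ hE]
  rfl

lemma LocMeasure.part_smul (n : ℕ) (c : ℂ) (μ : LocMeasure) : (c • μ).part n = c • μ.part n := by
  ext E hE
  change (c • μ).part n E = c • μ.part n E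
  simp only [LocMeasure.part_apply _ _ hE]
  rfl

lemma iUnion_inter_Ico (E : Set ℝ≥0) : ⋃ n : ℕ, E ∩ Ico (n : ℝ≥0) (n + 1) = E := by
  rw [← inter_iUnion]
  refine inter_eq_left.2 fun x _ => mem_iUnion.2 ⟨⌊x⌋₊, Nat.floor_le zero_le, ?_⟩
  exact Nat.lt_floor_add_one x

lemma pairwise_disjoint_Ico : Pairwise (Function.onFun Disjoint
    fun n : ℕ => Ico (n : ℝ≥0) (n + 1)) := by
  intro m n hmn
  refine Set.disjoint_left.2 fun x hm hn => hmn ?_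
  have h1 : ⌊x⌋₊ = m := (Nat.floor_eq_iff zero_le).2 hm
  have h2 : ⌊x⌋₊ = n := (Nat.floor_eq_iff zero_le).2 hn
  exact h1.symm.trans h2

lemma LocMeasure.ext_part {μ ν : LocMeasure} (h : ∀ n, μ.part n = ν.part n) : μ = ν := by
  apply Subtype.ext
  funext E
  by_cases hE : MeasurableSet E ∧ Bornology.IsBounded E
  · have key : ∀ ρ : LocMeasure, HasSum (fun n => ρ.part n E) (ρ.1 E) := by
      intro ρ
      have := ρ.2.2 (fun n : ℕ => E ∩ Ico (n : ℝ≥0) (n + 1))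
        (fun n => hE.1.inter measurableSet_Ico)
        (fun i j hij => (pairwise_disjoint_Ico hij).mono inter_subset_right inter_subset_right)
        (by rw [iUnion_inter_Ico]; exact hE.2)
      rw [iUnion_inter_Ico] at this
      simpa only [LocMeasure.part_apply _ _ hE.1] using this
    have h1 := key μ
    simp only [h] at h1
    exact h1.unique (key ν)
  · rw [μ.2.1 E hE, ν.2.1 E hE]

/-- `∫ ω(t) d|μ|(t)` as an extended non-negative number. -/
def mENorm (ω : Weight) (μ : LocMeasure) : ℝ≥0∞ := ∫⁻ t, (ω t : ℝ≥0∞) ∂μ.tv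

lemma mENorm_add_le (ω : Weight) (μ ν : LocMeasure) :
    mENorm ω (μ + ν) ≤ mENorm ω μ + mENorm ω ν := by
  simp only [mENorm, LocMeasure.tv, lintegral_sum_measure, LocMeasure.part_add]
  rw [← ENNReal.tsum_add]
  refine ENNReal.tsum_le_tsum fun n => ?_
  rw [← lintegral_add_measure]
  exact lintegral_mono' VectorMeasure.variation_add_le le_rfl

lemma mENorm_smul (ω : Weight) (c : ℂ) (μ : LocMeasure) :
    mENorm ω (c • μ) = ‖c‖ₑ * mENorm ω μ := by
  simp only [mENorm, LocMeasure.tv, lintegral_sum_measure, LocMeasure.part_smul]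
  rw [← ENNReal.tsum_mul_left]
  refine tsum_congr fun n => ?_
  rw [VectorMeasure.variation_smul, lintegral_smul_measure]
  rfl

lemma mENorm_eq_zero (ω : Weight) (μ : LocMeasure) : mENorm ω μ = 0 ↔ μ = 0 := by
  constructor
  · intro h
    apply LocMeasure.ext_part
    intro n
    simp only [mENorm, LocMeasure.tv, lintegral_sum_measure, ENNReal.tsum_eq_zero] at h
    have h1 := (lintegral_eq_zero_iff (ω.measurable.coe_nnreal_ennreal)).1 (h n)
    have h2 : (μ.part n).variation = 0 := by
      rw [← ae_eq_bot, ← Filter.eventually_false_iff_eq_bot]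
      filter_upwards [h1] with t ht
      exact (ω.pos t).ne' (by simpa using ht)
    rw [VectorMeasure.variation_eq_zero.1 h2]
    ext E hE
    rw [LocMeasure.part_apply _ _ hE]
    rfl
  · rintro rfl
    have := mENorm_smul ω 0 0
    simpa using this

/-- The locally finite complex measures `μ` with `∫ ω(t) d|μ|(t) < ∞`. -/
def mSubmodule (ω : Weight) : Submodule ℂ LocMeasure where
  carrier := {μ | mENorm ω μ < ∞}
  add_mem' {μ ν} hμ hν := (mENorm_add_le ω μ ν).trans_lt (ENNReal.add_lt_top.2 ⟨hμ, hν⟩)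
  zero_mem' := by
    change mENorm ω 0 < ∞
    rw [(mENorm_eq_zero ω 0).2 rfl]
    exact ENNReal.zero_lt_top
  smul_mem' c μ hμ := by
    change mENorm ω (c • μ) < ∞
    rw [mENorm_smul]
    exact ENNReal.mul_lt_top enorm_lt_top hμ

/-- The weighted space `M(ω)` of locally finite complex measures, with the norm
`∫ ω(t) d|μ|(t)`. -/
def WM (ω : Weight) : Type := mSubmodule ω

instance (ω : Weight) : AddCommGroup (WM ω) := inferInstanceAs (AddCommGroup (mSubmodule ω))
instance (ω : Weight) : Module ℂ (WM ω) := inferInstanceAs (Module ℂ (mSubmodule ω))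

/-- The locally finite complex measure underlying an element of `M(ω)`. -/
def WM.toLoc {ω : Weight} (μ : WM ω) : LocMeasure := μ.1

instance (ω : Weight) : Norm (WM ω) := ⟨fun μ => (mENorm ω μ.toLoc).toReal⟩

lemma WM.core (ω : Weight) : NormedSpace.Core ℂ (WM ω) where
  norm_nonneg _ := ENNReal.toReal_nonneg
  norm_smul c μ := by
    change (mENorm ω (c • μ.toLoc)).toReal = _ * (mENorm ω μ.toLoc).toReal
    rw [mENorm_smul]
    simp
  norm_triangle μ ν := by
    change (mENorm ω (μ.toLoc + ν.toLoc)).toReal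
      ≤ (mENorm ω μ.toLoc).toReal + (mENorm ω ν.toLoc).toReal
    have hμ : mENorm ω μ.toLoc < ∞ := μ.2
    have hν : mENorm ω ν.toLoc < ∞ := ν.2
    rw [← ENNReal.toReal_add hμ.ne hν.ne]
    exact ENNReal.toReal_mono (ENNReal.add_lt_top.2 ⟨μ.2, ν.2⟩).ne (mENorm_add_le ω _ _)
  norm_eq_zero_iff μ := by
    change (mENorm ω μ.toLoc).toReal = 0 ↔ _
    rw [ENNReal.toReal_eq_zero_iff, or_iff_left μ.2.ne, mENorm_eq_zero]
    exact ⟨fun h0 => Subtype.ext h0, fun h0 => by rw [h0]; rfl⟩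

instance (ω : Weight) : NormedAddCommGroup (WM ω) := NormedAddCommGroup.ofCore (WM.core ω)
instance (ω : Weight) : NormedSpace ℂ (WM ω) := NormedSpace.ofCore (WM.core ω)

/-- The duality `⟨g, μ⟩ = ∫ g dμ` between `C₀(ω)` and `M(ω)`. -/
def pairM {ω : Weight} (g : WC0 ω) (μ : WM ω) : ℂ := μ.toLoc.integral g

/-! ### The inclusion of `L¹(ω)` in `M(ω)` -/

lemma measurableEmbedding_coe : MeasurableEmbedding ((↑) : ℝ≥0 → ℝ) :=
  NNReal.isClosedEmbedding_coe.measurableEmbedding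

lemma leb_bounded {E : Set ℝ≥0} (hE : Bornology.IsBounded E) : leb E < ∞ := by
  rw [leb, measurableEmbedding_coe.comap_apply]
  have : Bornology.IsBounded (((↑) : ℝ≥0 → ℝ) '' E) := by
    have h1 : LipschitzWith 1 ((↑) : ℝ≥0 → ℝ) := LipschitzWith.subtype_val _
    exact h1.isBounded_image hE
  exact this.measure_lt_top

lemma WL1.integrable_smul {ω : Weight} (f : WL1 ω) : Integrable (fun t => ω t • f t) leb :=
  (integrable_withDensity_iff_integrable_smul ω.measurable).1 (L1.integrable_coeFn f)

lemma WL1.integrableOn {ω : Weight} (f : WL1 ω) {E : Set ℝ≥0} (hE : Bornology.IsBounded E) :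
    IntegrableOn f E leb := by
  obtain ⟨R, hR⟩ := hE.subset_closedBall 0
  have hK : IsCompact (Metric.closedBall (0 : ℝ≥0) R) := isCompact_closedBall _ _
  have h1 : IntegrableOn (fun t => ω t • f t) (Metric.closedBall 0 R) leb :=
    (WL1.integrable_smul f).integrableOn
  have hc : ContinuousOn (fun t => ((ω t)⁻¹ : ℝ≥0)) (Metric.closedBall (0 : ℝ≥0) R) :=
    (ω.continuous_toFun.inv₀ fun t => (ω.pos t).ne').continuousOn
  have hc' : ContinuousOn (fun t => (((ω t)⁻¹ : ℝ≥0) : ℝ)) (Metric.closedBall (0 : ℝ≥0) R) :=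
    NNReal.continuous_coe.comp_continuousOn hc
  have h2 := h1.continuousOn_smul hc' hK
  refine IntegrableOn.mono_set (h2.congr_fun (fun t _ => ?_) hK.measurableSet) hR
  change (ω t)⁻¹ • ω t • f t = f t
  rw [smul_smul, inv_mul_cancel₀ (ω.pos t).ne', one_smul]

open scoped Classical in
/-- The locally finite measure `f(t) dt`. -/
def WL1.toLoc {ω : Weight} (f : WL1 ω) : LocMeasure :=
  ⟨fun E => if MeasurableSet E ∧ Bornology.IsBounded E then ∫ t in E, f t ∂leb else 0,
    fun E hE => if_neg hE, fun E hE hd hb => by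
      have hbn : ∀ n, Bornology.IsBounded (E n) := fun n => hb.subset (subset_iUnion E n)
      simp only [hE, hbn, hb, MeasurableSet.iUnion hE, and_self, if_true]
      exact hasSum_integral_iUnion hE hd (WL1.integrableOn f hb)⟩

lemma WL1.mENorm_toLoc {ω : Weight} (f : WL1 ω) :
    mENorm ω (WL1.toLoc f) = ∫⁻ t, ‖f t‖ₑ ∂(leb.withDensity fun t => (ω t : ℝ≥0∞)) := by
  have hsm : AEStronglyMeasurable f leb := by
    have h := (WL1.integrable_smul f).aestronglyMeasurable
    have hi : Measurable fun t => (((ω t)⁻¹ : ℝ≥0) : ℝ) :=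
      measurable_coe_nnreal_real.comp ω.measurable.inv
    refine (hi.aestronglyMeasurable.smul h).congr (Filter.Eventually.of_forall fun t => ?_)
    change (ω t)⁻¹ • ω t • f t = f t
    rw [smul_smul, inv_mul_cancel₀ (ω.pos t).ne', one_smul]
  have hpart : ∀ n : ℕ, ((WL1.toLoc f).part n).variation
      = (leb.restrict (Ico (n : ℝ≥0) (n + 1))).withDensity fun t => ‖f t‖ₑ := by
    intro n
    have hi : Integrable f (leb.restrict (Ico (n : ℝ≥0) (n + 1))) :=
      WL1.integrableOn f (isBounded_Ico _ _)
    rw [← Measure.variation_withDensityᵥ hi]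
    congr 1
    ext E hE
    rw [LocMeasure.part_apply _ _ hE, withDensityᵥ_apply hi hE, Measure.restrict_restrict hE]
    exact if_pos ⟨hE.inter measurableSet_Ico,
      (isBounded_Ico (n : ℝ≥0) (n + 1)).subset inter_subset_right⟩
  have hωm : AEMeasurable (fun t => (ω t : ℝ≥0∞)) leb := ω.measurable.coe_nnreal_ennreal.aemeasurable
  simp only [mENorm, LocMeasure.tv, lintegral_sum_measure, hpart]
  rw [lintegral_withDensity_eq_lintegral_mul₀ hωm hsm.enorm]
  have hU : ⋃ n : ℕ, Ico (n : ℝ≥0) (n + 1) = univ := by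
    simpa using iUnion_inter_Ico univ
  rw [← setLIntegral_univ, ← hU, lintegral_iUnion (fun _ => measurableSet_Ico)
    pairwise_disjoint_Ico]
  refine tsum_congr fun n => ?_
  rw [lintegral_withDensity_eq_lintegral_mul₀ hsm.enorm.restrict hωm.restrict]
  refine lintegral_congr fun t => ?_
  simp [mul_comm]

/-- The inclusion of `L¹(ω)` in `M(ω)`, which identifies `f` with the measure `f(t) dt`. -/
def WL1.toM {ω : Weight} (f : WL1 ω) : WM ω :=
  ⟨WL1.toLoc f, by
    change mENorm ω _ < ∞
    rw [WL1.mENorm_toLoc]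
    exact (L1.integrable_coeFn f).hasFiniteIntegral⟩

/-! ### The operators -/

/-- Condition (C): there is a constant `C` with
`∫₀¹ ω₂(s/t) ψ(t)/t dt ≤ C ω₁(s)` for every `s ≥ 0`. -/
def ConditionC (ψ : ℝ≥0 → ℝ≥0) (ω₁ ω₂ : Weight) : Prop :=
  ∃ C : ℝ≥0, ∀ s : ℝ≥0,
    ∫⁻ t in Icc 0 1, ((ω₂ (s / t) * (ψ t / t) : ℝ≥0) : ℝ≥0∞) ∂leb ≤ ((C * ω₁ s : ℝ≥0) : ℝ≥0∞)

/-- `U` is the generalized Hardy-Cesàro operator `(U f)(x) = ∫₀¹ f(t x) ψ(t) dt` from `L¹(ω₁)` to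
`L¹(ω₂)`; the integral exists for almost every `x`. -/
def IsHardyCesaro (ψ : ℝ≥0 → ℝ≥0) {ω₁ ω₂ : Weight} (U : WL1 ω₁ →L[ℂ] WL1 ω₂) : Prop :=
  ∀ f : WL1 ω₁, ∀ᵐ x ∂leb,
    IntegrableOn (fun t => f (t * x) * ((ψ t : ℝ) : ℂ)) (Icc 0 1) leb ∧
      U f x = ∫ t in Icc 0 1, f (t * x) * ((ψ t : ℝ) : ℂ) ∂leb

/-- `S` is the adjoint of `U`, the dual of `L¹(ω)` being identified with `L^∞(1/ω)`:
`⟨f, S h⟩ = ⟨U f, h⟩`. -/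
def IsAdjointL {ω₁ ω₂ : Weight} (U : WL1 ω₁ →L[ℂ] WL1 ω₂) (S : WLinf ω₂ →L[ℂ] WLinf ω₁) : Prop :=
  ∀ (f : WL1 ω₁) (h : WLinf ω₂), pairL f (S h) = pairL (U f) h

/-- `V` is the restriction of `S` to `C₀(ω₂)`, viewed as a map into `C₀(ω₁)`. -/
def IsRestrictionC0 {ω₁ ω₂ : Weight} (S : WLinf ω₂ →L[ℂ] WLinf ω₁) (V : WC0 ω₂ →L[ℂ] WC0 ω₁) : Prop :=
  ∀ g : WC0 ω₂, (V g).toLinf = S g.toLinf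

/-- `T` is the adjoint of `V`, the dual of `C₀(ω)` being identified with `M(ω)`:
`⟨g, T μ⟩ = ⟨V g, μ⟩`. -/
def IsAdjointM {ω₁ ω₂ : Weight} (V : WC0 ω₂ →L[ℂ] WC0 ω₁) (T : WM ω₁ →L[ℂ] WM ω₂) : Prop :=
  ∀ (g : WC0 ω₂) (μ : WM ω₁), pairM g (T μ) = pairM (V g) μ

end HardyCesaro

end

open HardyCesaro

noncomputable section

namespace HardyCesaro

/-! Let κ be the measure ψ(t)/t dt on [0,1] (`dilationKernel`). Then (U f)(x) = ∫ f(tx) t dκ(t), and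
condition (C) reads ∫ ω₂(s/t) dκ(t) ≤ C ω₁(s). At s = 0 this says that κ is finite. The rest of the
argument uses only κ.

Integrating (C) against |u| dm gives the basic estimate `lintegral_prod_le`, for any s-finite
measure m. With m Lebesgue measure and the substitution s = tx it bounds U on L¹. Fubini and the
same substitution give (U*h)(s) = ∫ h(s/t) dκ(t) (`pairL_eq_of_ae_eq`), which (C) bounds pointwise.
If h is continuous with compact support, so is U*h, because κ is finite and s/t ≥ s for 0 < t ≤ 1;
the weighted bound and density extend this to C₀ (`exists_c0`).

For measures, write dμ = u d|μ|. The image of μ is the push-forward of u(s) d(|μ| × κ) under (s,t) ↦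
s/t. The basic estimate with m = |μ| bounds it, and Fubini identifies its pairing with C₀(ω₂)
(`exists_pairM_eq`).

The full dual space identifications are never needed. Each operator is defined by a linear relation
between vectors, so by `existsUnique_clm_of_relation` it is enough to have an explicit solution with
a norm bound and a pairing that separates points (`eq_of_pairL_eq`, `WC0.toLinf_injective`,
`eq_of_pairM_eq`). The extension property then follows from ⟨g, T f⟩ = ⟨V g, f⟩ = ⟨f, S g⟩ = ⟨U f,
g⟩, since C₀(ω₂) separates the points of M(ω₂). -/

/-- A relation that behaves like the graph of a bounded linear operator is one. -/
lemma existsUnique_clm_of_relation {E F : Type*} [NormedAddCommGroup E] [NormedSpace ℂ E]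
    [NormedAddCommGroup F] [NormedSpace ℂ F] (R : E → F → Prop) (K : ℝ)
    (exists_le : ∀ x, ∃ y, R x y ∧ ‖y‖ ≤ K * ‖x‖)
    (unique : ∀ x y z, R x y → R x z → y = z)
    (add : ∀ x x' y y', R x y → R x' y' → R (x + x') (y + y'))
    (smul : ∀ (c : ℂ) x y, R x y → R (c • x) (c • y)) :
    ∃! T : E →L[ℂ] F, ∀ x, R x (T x) := by
  choose T hT hle using exists_le
  refine ⟨LinearMap.mkContinuous
    { toFun := T
      map_add' := fun x y => unique _ _ _ (hT _) (add _ _ _ _ (hT _) (hT _))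
      map_smul' := fun c x => unique _ _ _ (hT _) (smul _ _ _ (hT _)) } K hle, hT, ?_⟩
  intro S hS
  ext x
  exact unique _ _ _ (hS x) (hT x)

/-! ### Lebesgue measure on the half-line and dilations -/

instance : IsFiniteMeasureOnCompacts leb := ⟨fun _ hK => leb_bounded hK.isBounded⟩

instance : IsLocallyFiniteMeasure leb := isLocallyFiniteMeasure_of_isFiniteMeasureOnCompacts

lemma leb_apply (E : Set ℝ≥0) : leb E = volume (((↑) : ℝ≥0 → ℝ) '' E) :=
  measurableEmbedding_coe.comap_apply _ _

/-- This is what makes a continuous function determined by its class, so that C₀(ω) embeds in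
L^∞(1/ω). -/
instance : leb.IsOpenPosMeasure := by
  refine ⟨fun U hU ⟨x, hx⟩ h0 => ?_⟩
  have hn : U ∈ nhds x := hU.mem_nhds hx
  obtain ⟨b, hb, hs⟩ := exists_Ico_subset_of_mem_nhds hn ⟨x + 1, by simp⟩
  have h1 : leb (Ico x b) = 0 := measure_mono_null hs h0
  rw [leb_apply] at h1
  have h2 : Ico (x : ℝ) b ⊆ ((↑) : ℝ≥0 → ℝ) '' Ico x b := fun y hy =>
    ⟨⟨y, x.2.trans hy.1⟩, ⟨hy.1, hy.2⟩, rfl⟩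
  have h3 := measure_mono_null h2 h1
  rw [Real.volume_Ico] at h3
  simp only [ENNReal.ofReal_eq_zero, tsub_le_iff_right, zero_add, NNReal.coe_le_coe] at h3
  exact absurd hb h3.not_gt

instance : NullSingletonClass leb := by
  refine ⟨fun x => ?_⟩
  rw [leb_apply]
  simp

/-- Dilation by `t > 0` scales Lebesgue measure by `t⁻¹`. -/
lemma leb_preimage_mul_left {t : ℝ≥0} (ht : t ≠ 0) (E : Set ℝ≥0) :
    leb ((t * ·) ⁻¹' E) = ((t⁻¹ : ℝ≥0) : ℝ≥0∞) * leb E := by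
  rw [leb_apply, leb_apply]
  have : ((↑) : ℝ≥0 → ℝ) '' ((t * ·) ⁻¹' E)
      = (((t : ℝ) * ·) ⁻¹' (((↑) : ℝ≥0 → ℝ) '' E)) := by
    ext y
    constructor
    · rintro ⟨x, hx, rfl⟩
      exact ⟨t * x, hx, by simp⟩
    · rintro ⟨x, hx, hxy⟩
      have hxy' : (x : ℝ) = t * y := hxy
      have ht' : (0 : ℝ) < t := NNReal.coe_pos.2 (pos_iff_ne_zero.2 ht)
      have hy : 0 ≤ y := by
        have := x.2
        rw [NNReal.val_eq_coe, hxy'] at this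
        exact nonneg_of_mul_nonneg_right this ht'
      refine ⟨⟨y, hy⟩, ?_, rfl⟩
      have : t * ⟨y, hy⟩ = x := NNReal.eq hxy'.symm
      exact (congrArg (· ∈ E) this).mpr hx
  rw [this, Real.volume_preimage_mul_left (NNReal.coe_ne_zero.2 ht), abs_of_nonneg (by positivity),
    ← NNReal.coe_inv, ENNReal.ofReal_coe_nnreal]

lemma map_mul_left_leb {t : ℝ≥0} (ht : t ≠ 0) :
    leb.map (t * ·) = (t⁻¹ : ℝ≥0) • leb := by
  ext E hE
  rw [Measure.map_apply (measurable_const_mul t) hE, leb_preimage_mul_left ht]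
  rfl

lemma lintegral_comp_mul_left {t : ℝ≥0} (ht : t ≠ 0) {F : ℝ≥0 → ℝ≥0∞} (hF : Measurable F) :
    ∫⁻ x, t * F (t * x) ∂leb = ∫⁻ s, F s ∂leb := by
  have hm : Measurable fun x => F (t * x) := hF.comp (measurable_const_mul t)
  rw [lintegral_const_mul _ hm, ← lintegral_map hF (measurable_const_mul t), map_mul_left_leb ht, lintegral_smul_measure,
    ENNReal.smul_def, smul_eq_mul, ← mul_assoc, ← ENNReal.coe_mul, mul_inv_cancel₀ ht,
    ENNReal.coe_one, one_mul]

/-! ### Integration against a vector measure with a density -/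

/-- The variation of u dP is ‖u‖ dP, so both sides are linear and continuous in f for the norm of
L¹(‖u‖ dP); it is enough to check indicators. -/
lemma integral_withDensityᵥ_mul {X : Type*} [MeasurableSpace X] {P : Measure X} {u : X → ℂ}
    (hu : Integrable u P) {f : X → ℂ} (hf : (P.withDensityᵥ u).Integrable f) :
    VectorMeasure.integral (P.withDensityᵥ u) f (ContinuousLinearMap.mul ℝ ℂ)
      = ∫ x, f x * u x ∂P := by
  unfold VectorMeasure.Integrable at hf
  have hvar := Measure.variation_withDensityᵥ hu
  have hun : AEMeasurable (fun x => ‖u x‖ₑ) P := hu.aestronglyMeasurable.enorm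
  have hfin : ∀ᵐ x ∂P, ‖u x‖ₑ < ∞ := Filter.Eventually.of_forall fun x => enorm_lt_top
  have hint : ∀ g : X → ℂ, Integrable g (P.withDensityᵥ u).variation →
      Integrable (fun x => g x * u x) P := by
    intro g hg
    rw [hvar, integrable_withDensity_iff_integrable_smul₀' hun hfin] at hg
    -- Multiplying the integrable function ‖u‖ g by the phase u/‖u‖, which is bounded by 1 and is 0
    -- where u vanishes, gives g u.
    have h1 : AEStronglyMeasurable (fun x => (‖u x‖⁻¹ : ℝ) • u x) P :=
      hu.aestronglyMeasurable.norm.inv₀.smul hu.aestronglyMeasurable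
    refine (hg.mul_bdd (c := 1) h1 ?_).congr ?_
    · filter_upwards with x using by simp [inv_mul_le_one]
    · filter_upwards with x
      rcases eq_or_ne (u x) 0 with hx | hx
      · simp [hx]
      · have hx' : ((‖u x‖ : ℝ) : ℂ) ≠ 0 := by simpa using hx
        simp
        field_simp
  have hnorm : ∀ g : X → ℂ, Integrable g (P.withDensityᵥ u).variation →
      ‖∫ x, g x * u x ∂P‖ ≤ ∫ x, ‖g x‖ ∂(P.withDensityᵥ u).variation := by
    intro g hg
    refine (norm_integral_le_integral_norm _).trans (le_of_eq ?_)
    rw [hvar, integral_withDensity_eq_integral_toReal_smul₀ hun hfin]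
    simp [mul_comm]
  revert f
  refine Integrable.induction _ ?_ ?_ ?_ ?_
  · intro c s hs hfs
    have : IsFiniteMeasure ((P.withDensityᵥ u).variation.restrict s) := ⟨by simpa⟩
    rw [VectorMeasure.integral_indicator_const _ hs, withDensityᵥ_apply hu hs]
    have h1 : (fun x => s.indicator (fun _ => c) x * u x) = s.indicator (fun x => c * u x) := by
      ext x
      by_cases hx : x ∈ s <;> simp [hx]
    rw [h1, integral_indicator hs, integral_const_mul]
    rfl
  · intro f g _ hf hg h1 h2
    have := VectorMeasure.integral_add (B := ContinuousLinearMap.mul ℝ ℂ) hf hg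
    rw [this, h1, h2, ← integral_add (hint f hf) (hint g hg)]
    simp [add_mul]
  · refine isClosed_eq VectorMeasure.continuous_integral ?_
    refine LipschitzWith.continuous (K := 1) (LipschitzWith.of_dist_le_mul fun f g => ?_)
    have hf := L1.integrable_coeFn f
    have hg := L1.integrable_coeFn g
    rw [dist_eq_norm, dist_eq_norm, ← integral_sub (hint f hf) (hint g hg), L1.norm_eq_integral_norm,
      NNReal.coe_one, one_mul]
    simp_rw [← sub_mul]
    refine (hnorm _ (hf.sub hg)).trans (le_of_eq (integral_congr_ae ?_))
    filter_upwards [Lp.coeFn_sub f g] with x hx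
    rw [hx]
  · intro f g hfg _ h
    rw [← VectorMeasure.integral_congr_ae hfg, h]
    refine integral_congr_ae ?_
    rw [hvar] at hfg
    -- The two functions need to agree only where u ≠ 0; elsewhere both integrands vanish.
    filter_upwards [(ae_withDensity_iff' hun).1 hfg] with x hx
    by_cases h0 : u x = 0
    · simp [h0]
    · rw [hx (by simpa using h0)]

/-! ### Locally finite measures as push-forwards of densities -/

/-- `μ` is the push-forward under `φ` of the complex measure `u dP`. -/
structure Represents {X : Type*} [MeasurableSpace X] (P : Measure X) (φ : X → ℝ≥0) (u : X → ℂ)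
    (μ : LocMeasure) : Prop where
  measurable : Measurable φ
  integrableOn : ∀ n : ℕ, IntegrableOn u (φ ⁻¹' Ico (n : ℝ≥0) (n + 1)) P
  part_eq : ∀ n : ℕ, μ.part n = ((P.restrict (φ ⁻¹' Ico (n : ℝ≥0) (n + 1))).withDensityᵥ u).map φ

lemma iUnion_Ico : ⋃ n : ℕ, Ico (n : ℝ≥0) (n + 1) = univ := by
  simpa using iUnion_inter_Ico univ

lemma represents_of_apply {X : Type*} [MeasurableSpace X] {P : Measure X} {φ : X → ℝ≥0}
    {u : X → ℂ} {μ : LocMeasure} (hφ : Measurable φ)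
    (hu : ∀ E, MeasurableSet E → Bornology.IsBounded E → IntegrableOn u (φ ⁻¹' E) P)
    (hμ : ∀ E, MeasurableSet E → Bornology.IsBounded E → μ.1 E = ∫ x in φ ⁻¹' E, u x ∂P) :
    Represents P φ u μ where
  measurable := hφ
  integrableOn n := hu _ measurableSet_Ico (isBounded_Ico _ _)
  part_eq n := by
    ext E hE
    rw [LocMeasure.part_apply _ _ hE, VectorMeasure.map_apply _ hφ hE,
      withDensityᵥ_apply (hu _ measurableSet_Ico (isBounded_Ico _ _)) (hφ hE),
      Measure.restrict_restrict (hφ hE),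
      hμ _ (hE.inter measurableSet_Ico) ((isBounded_Ico _ _).subset inter_subset_right),
      preimage_inter]

open scoped Classical in
lemma exists_represents {X : Type*} [MeasurableSpace X] {P : Measure X} {φ : X → ℝ≥0}
    {u : X → ℂ} (hφ : Measurable φ)
    (hu : ∀ E, MeasurableSet E → Bornology.IsBounded E → IntegrableOn u (φ ⁻¹' E) P) :
    ∃ μ : LocMeasure, Represents P φ u μ :=
  ⟨⟨fun E => if MeasurableSet E ∧ Bornology.IsBounded E then ∫ x in φ ⁻¹' E, u x ∂P else 0,
    fun E hE => if_neg hE, fun E hE hd hb => by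
      have hbn : ∀ n, Bornology.IsBounded (E n) := fun n => hb.subset (subset_iUnion E n)
      simp only [hE, hbn, hb, MeasurableSet.iUnion hE, and_self, if_true, preimage_iUnion]
      refine hasSum_integral_iUnion (fun n => hφ (hE n))
        (fun i j hij => (hd hij).preimage φ) ?_
      rw [← preimage_iUnion]
      exact hu _ (MeasurableSet.iUnion hE) hb⟩,
    represents_of_apply hφ hu fun _ hE hb => if_pos ⟨hE, hb⟩⟩

namespace Represents

variable {X : Type*} [MeasurableSpace X] {P : Measure X} {φ : X → ℝ≥0} {u : X → ℂ}
  {μ : LocMeasure}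

lemma aestronglyMeasurable (h : Represents P φ u μ) : AEStronglyMeasurable u P := by
  have h1 := (aestronglyMeasurable_iUnion_iff (f := u) (μ := P)
    (s := fun n : ℕ => φ ⁻¹' Ico (n : ℝ≥0) (n + 1))).2 fun n => (h.integrableOn n).1
  rwa [← preimage_iUnion, iUnion_Ico, preimage_univ, Measure.restrict_univ] at h1

lemma tsum_setLIntegral (hφ : Measurable φ) (F : X → ℝ≥0∞) :
    ∑' n : ℕ, ∫⁻ x in φ ⁻¹' Ico (n : ℝ≥0) (n + 1), F x ∂P = ∫⁻ x, F x ∂P := by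
  rw [← lintegral_iUnion (fun n => hφ measurableSet_Ico)
    (fun i j hij => (pairwise_disjoint_Ico hij).preimage φ), ← preimage_iUnion, iUnion_Ico,
    preimage_univ, Measure.restrict_univ]

/-- Only an inequality in general: mass may cancel when φ identifies points. For φ = id nothing
cancels, and `mENorm_eq` holds. -/
lemma mENorm_le (h : Represents P φ u μ) (ω : Weight) :
    mENorm ω μ ≤ ∫⁻ x, ω (φ x) * ‖u x‖ₑ ∂P := by
  rw [mENorm, LocMeasure.tv, lintegral_sum_measure, ← tsum_setLIntegral h.measurable]
  refine ENNReal.tsum_le_tsum fun n => ?_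
  have hω : Measurable fun t => (ω t : ℝ≥0∞) := ω.measurable.coe_nnreal_ennreal
  rw [h.part_eq n]
  refine (lintegral_mono' VectorMeasure.variation_map_le le_rfl).trans (le_of_eq ?_)
  have hωφ : Measurable fun x => (ω (φ x) : ℝ≥0∞) := hω.comp h.measurable
  rw [Measure.variation_withDensityᵥ (h.integrableOn n), lintegral_map hω h.measurable,
    lintegral_withDensity_eq_lintegral_mul₀ (h.integrableOn n).1.enorm
      hωφ.aemeasurable]
  refine lintegral_congr fun x => ?_
  simp [mul_comm]

lemma mENorm_eq {m : Measure ℝ≥0} {u : ℝ≥0 → ℂ} (h : Represents m id u μ) (ω : Weight) :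
    mENorm ω μ = ∫⁻ t, ω t * ‖u t‖ₑ ∂m := by
  rw [mENorm, LocMeasure.tv, lintegral_sum_measure, ← tsum_setLIntegral measurable_id]
  refine tsum_congr fun n => ?_
  have hω : Measurable fun t => (ω t : ℝ≥0∞) := ω.measurable.coe_nnreal_ennreal
  rw [h.part_eq n, VectorMeasure.map_id, Measure.variation_withDensityᵥ (h.integrableOn n),
    lintegral_withDensity_eq_lintegral_mul₀ (h.integrableOn n).1.enorm hω.aemeasurable]
  refine lintegral_congr fun x => ?_
  simp [mul_comm]

/-- The preimages of the intervals [n, n+1) partition X, so countable additivity of the integral of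
an integrable function makes the series of pieces converge. -/
lemma hasSum_integral (h : Represents P φ u μ) {g : ℝ≥0 → ℂ} (hg : Measurable g)
    (hgu : Integrable (fun x => g (φ x) * u x) P) :
    HasSum (fun n => VectorMeasure.integral (μ.part n) g (ContinuousLinearMap.mul ℝ ℂ))
      (∫ x, g (φ x) * u x ∂P) := by
  have hmeas : ∀ n : ℕ, MeasurableSet (φ ⁻¹' Ico (n : ℝ≥0) (n + 1)) :=
    fun n => h.measurable measurableSet_Ico
  have hU : ⋃ n : ℕ, φ ⁻¹' Ico (n : ℝ≥0) (n + 1) = univ := by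
    rw [← preimage_iUnion, iUnion_Ico, preimage_univ]
  have h1 := hasSum_integral_iUnion (f := fun x => g (φ x) * u x) (μ := P) hmeas
    (fun i j hij => (pairwise_disjoint_Ico hij).preimage φ) (by rw [hU]; exact hgu.integrableOn)
  rw [hU, Measure.restrict_univ] at h1
  refine h1.congr_fun fun n => ?_
  have hi : ((P.restrict (φ ⁻¹' Ico (n : ℝ≥0) (n + 1))).withDensityᵥ u).Integrable (g ∘ φ) := by
    unfold VectorMeasure.Integrable
    rw [Measure.variation_withDensityᵥ (h.integrableOn n),
      integrable_withDensity_iff_integrable_smul₀' (h.integrableOn n).1.enorm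
        (Filter.Eventually.of_forall fun x => enorm_lt_top)]
    refine Integrable.mono (hgu.integrableOn (s := φ ⁻¹' Ico (n : ℝ≥0) (n + 1)))
      ((h.integrableOn n).1.enorm.ennreal_toReal.aestronglyMeasurable.smul
        (hg.comp h.measurable).aestronglyMeasurable) ?_
    filter_upwards with x
    simp [mul_comm]
  rw [h.part_eq n, VectorMeasure.integral_map h.measurable hg.aestronglyMeasurable hi]
  exact integral_withDensityᵥ_mul (h.integrableOn n) hi

lemma integral_eq (h : Represents P φ u μ) {g : ℝ≥0 → ℂ} (hg : Measurable g)
    (hgu : Integrable (fun x => g (φ x) * u x) P) :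
    μ.integral g = ∫ x, g (φ x) * u x ∂P :=
  (h.hasSum_integral hg hgu).tsum_eq

end Represents

/-! ### Polar decomposition of locally finite complex measures -/

/-- A complex measure is absolutely continuous with respect to its variation, so Radon–Nikodym
applies to its real and imaginary parts separately. -/
lemma withDensityᵥ_rnDeriv_variation {X : Type*} [MeasurableSpace X] (c : ComplexMeasure X)
    [SigmaFinite c.variation] : c.variation.withDensityᵥ (c.rnDeriv c.variation) = c := by
  obtain ⟨hre, him⟩ :=
    (c.absolutelyContinuous_ennreal_iff _).1 (VectorMeasure.absolutelyContinuous c)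
  have h1 := SignedMeasure.withDensityᵥ_rnDeriv_eq _ _ hre
  have h2 := SignedMeasure.withDensityᵥ_rnDeriv_eq _ _ him
  ext E hE
  have hi := c.integrable_rnDeriv c.variation
  rw [withDensityᵥ_apply hi hE]
  apply Complex.ext
  · rw [← RCLike.re_eq_complex_re, ← integral_re hi.integrableOn]
    have := congrArg (fun s => s E) h1
    simp only [withDensityᵥ_apply (SignedMeasure.integrable_rnDeriv _ _) hE] at this
    exact this
  · rw [← RCLike.im_eq_complex_im, ← integral_im hi.integrableOn]
    have := congrArg (fun s => s E) h2
    simp only [withDensityᵥ_apply (SignedMeasure.integrable_rnDeriv _ _) hE] at this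
    exact this

/-- A positive weight is bounded below on bounded sets. -/
lemma Weight.exists_le (ω : Weight) {E : Set ℝ≥0} (hE : Bornology.IsBounded E) :
    ∃ c : ℝ≥0, 0 < c ∧ ∀ t ∈ E, c ≤ ω t := by
  rcases E.eq_empty_or_nonempty with rfl | hne
  · exact ⟨1, one_pos, fun t ht => ht.elim⟩
  · obtain ⟨t, -, ht⟩ :=
      hE.isCompact_closure.exists_isMinOn hne.closure ω.continuous_toFun.continuousOn
    exact ⟨ω t, ω.pos t, fun s hs => ht (subset_closure hs)⟩

lemma LocMeasure.variation_part_compl (μ : LocMeasure) (n : ℕ) :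
    (μ.part n).variation (Ico (n : ℝ≥0) (n + 1))ᶜ = 0 := by
  rw [VectorMeasure.variation_apply_eq_zero measurableSet_Ico.compl]
  intro t ht htm
  rw [LocMeasure.part_apply _ _ htm, (disjoint_compl_left.mono_left ht).inter_eq, μ.empty]

/-- The k-th summand of |μ| is carried by [k, k+1), and these intervals are disjoint, so only the
n-th summand survives. -/
lemma LocMeasure.tv_restrict (μ : LocMeasure) (n : ℕ) :
    μ.tv.restrict (Ico (n : ℝ≥0) (n + 1)) = (μ.part n).variation := by
  have hself : ∀ k : ℕ, (μ.part k).variation.restrict (Ico (k : ℝ≥0) (k + 1))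
      = (μ.part k).variation := fun k =>
    Measure.restrict_eq_self_of_ae_mem (mem_ae_iff.2 (μ.variation_part_compl k))
  ext E hE
  rw [LocMeasure.tv, Measure.restrict_apply hE, Measure.sum_apply _ (hE.inter measurableSet_Ico),
    tsum_eq_single n, ← Measure.restrict_apply hE, hself]
  intro k hk
  refine measure_mono_null ?_ (μ.variation_part_compl k)
  exact fun x hx hx' => Set.disjoint_left.1 (pairwise_disjoint_Ico hk) hx' hx.2

/-- With ω ≥ c > 0 on K, one has c |μ|(K) ≤ ∫ ω d|μ| < ∞. -/
lemma WM.isFiniteMeasureOnCompacts_tv {ω : Weight} (μ : WM ω) :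
    IsFiniteMeasureOnCompacts μ.toLoc.tv := by
  refine ⟨fun K hK => ?_⟩
  obtain ⟨c, hc, hcK⟩ := ω.exists_le hK.isBounded
  have h1 : ∫⁻ t in K, (c : ℝ≥0∞) ∂μ.toLoc.tv ≤ mENorm ω μ.toLoc :=
    (setLIntegral_mono ω.measurable.coe_nnreal_ennreal
      fun t ht => ENNReal.coe_le_coe.2 (hcK t ht)).trans (setLIntegral_le_lintegral _ _)
  rw [setLIntegral_const] at h1
  by_contra hK'
  rw [not_lt, top_le_iff] at hK'
  rw [hK', ENNReal.mul_top (by exact_mod_cast hc.ne')] at h1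
  exact absurd μ.2 (not_lt.2 h1)

/-- Polar decomposition of an element of `M(ω)`. -/
lemma WM.exists_represents_id {ω : Weight} (μ : WM ω) :
    ∃ u : ℝ≥0 → ℂ, Represents μ.toLoc.tv id u μ.toLoc := by
  have := μ.isFiniteMeasureOnCompacts_tv
  have hfin : ∀ n, IsFiniteMeasure (μ.toLoc.part n).variation := by
    intro n
    rw [← LocMeasure.tv_restrict]
    exact ⟨by rw [Measure.restrict_apply_univ]; exact (isBounded_Ico _ _).measure_lt_top⟩
  -- The densities of the pieces are glued: t lies in the piece with index ⌊t⌋.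
  let u : ℝ≥0 → ℂ := fun t =>
    ComplexMeasure.rnDeriv (μ.toLoc.part ⌊t⌋₊) (μ.toLoc.part ⌊t⌋₊).variation t
  have hu : ∀ n : ℕ, u =ᵐ[(μ.toLoc.part n).variation]
      ComplexMeasure.rnDeriv (μ.toLoc.part n) (μ.toLoc.part n).variation := by
    intro n
    filter_upwards [mem_ae_iff.2 (μ.toLoc.variation_part_compl n)] with t ht
    have : ⌊t⌋₊ = n := (Nat.floor_eq_iff zero_le).2 ht
    simp only [u, this]
  have hi : ∀ n : ℕ, Integrable u (μ.toLoc.part n).variation := fun n =>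
    (ComplexMeasure.integrable_rnDeriv _ _).congr (hu n).symm
  refine ⟨u, measurable_id, fun n => ?_, fun n => ?_⟩
  · rw [preimage_id, IntegrableOn, LocMeasure.tv_restrict]
    exact hi n
  · rw [preimage_id, LocMeasure.tv_restrict, VectorMeasure.map_id]
    conv_lhs => rw [← withDensityᵥ_rnDeriv_variation (μ.toLoc.part n)]
    exact WithDensityᵥEq.congr_ae (hu n).symm

lemma WL1.represents {ω : Weight} (f : WL1 ω) : Represents leb id f (WL1.toLoc f) :=
  represents_of_apply measurable_id (fun _ _ hb => WL1.integrableOn f hb)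
    fun _ hE hb => if_pos ⟨hE, hb⟩

/-! ### The space `L¹(ω)` in terms of Lebesgue measure -/

lemma Weight.ae_withDensity_iff (ω : Weight) {p : ℝ≥0 → Prop} :
    (∀ᵐ t ∂(leb.withDensity fun t => (ω t : ℝ≥0∞)), p t) ↔ ∀ᵐ t ∂leb, p t := by
  rw [MeasureTheory.ae_withDensity_iff ω.measurable.coe_nnreal_ennreal]
  refine Filter.eventually_congr (Filter.Eventually.of_forall fun t => ?_)
  simp [(ω.pos t).ne']

namespace WL1

variable {ω : Weight}

lemma measurable (f : WL1 ω) : Measurable f := (Lp.stronglyMeasurable f).measurable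

lemma ext_leb {f g : WL1 ω} (h : f =ᵐ[leb] g) : f = g :=
  Lp.ext (ω.ae_withDensity_iff.2 h)

lemma lintegral_enorm (f : WL1 ω) :
    ∫⁻ t, ω t * ‖f t‖ₑ ∂leb = ENNReal.ofReal ‖f‖ := by
  rw [ofReal_norm, ← WL1.represents f |>.mENorm_eq ω, WL1.mENorm_toLoc, Lp.enorm_def,
    eLpNorm_one_eq_lintegral_enorm]

lemma lintegral_enorm_ne_top (f : WL1 ω) : ∫⁻ t, ω t * ‖f t‖ₑ ∂leb ≠ ∞ := by
  rw [lintegral_enorm]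
  exact ENNReal.ofReal_ne_top

lemma exists_ae_eq {F : ℝ≥0 → ℂ} (hF : AEStronglyMeasurable F leb)
    (hfin : ∫⁻ t, ω t * ‖F t‖ₑ ∂leb ≠ ∞) : ∃ f : WL1 ω, f =ᵐ[leb] F := by
  have hω : Measurable fun t => (ω t : ℝ≥0∞) := ω.measurable.coe_nnreal_ennreal
  have hi : Integrable F (leb.withDensity fun t => (ω t : ℝ≥0∞)) := by
    refine ⟨hF.mono_ac (withDensity_absolutelyContinuous _ _), ?_⟩
    rw [HasFiniteIntegral, lintegral_withDensity_eq_lintegral_mul₀ hω.aemeasurable hF.enorm]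
    exact hfin.lt_top
  exact ⟨hi.toL1 F, ω.ae_withDensity_iff.1 hi.coeFn_toL1⟩

lemma norm_le_of_lintegral_le {f : WL1 ω} {K : ℝ} (hK : 0 ≤ K)
    (h : ∫⁻ t, ω t * ‖f t‖ₑ ∂leb ≤ ENNReal.ofReal K) : ‖f‖ ≤ K := by
  rw [lintegral_enorm] at h
  exact (ENNReal.ofReal_le_ofReal_iff hK).1 h

lemma coeFn_add (f g : WL1 ω) : ∀ᵐ t ∂leb, (f + g) t = f t + g t :=
  ω.ae_withDensity_iff.1 (Lp.coeFn_add f g)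

lemma coeFn_smul (c : ℂ) (f : WL1 ω) : ∀ᵐ t ∂leb, (c • f) t = c * f t :=
  ω.ae_withDensity_iff.1 (Lp.coeFn_smul c f)

/-- Indicators of compact sets belong to `L¹(ω)`. -/
lemma exists_ae_eq_indicator (ω : Weight) {K : Set ℝ≥0} (hK : IsCompact K) :
    ∃ f : WL1 ω, f =ᵐ[leb] K.indicator 1 := by
  have hm : MeasurableSet K := hK.measurableSet
  refine exists_ae_eq ((measurable_one.indicator hm).aestronglyMeasurable) ?_
  have h1 : ∀ t, (ω t : ℝ≥0∞) * ‖K.indicator (1 : ℝ≥0 → ℂ) t‖ₑ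
      = K.indicator (fun t => (ω t : ℝ≥0∞)) t := by
    intro t
    by_cases ht : t ∈ K <;> simp [ht]
  simp_rw [h1]
  rw [lintegral_indicator hm]
  obtain ⟨C, hC⟩ := hK.exists_bound_of_continuousOn
    (NNReal.continuous_coe.comp ω.continuous_toFun).continuousOn
  have h2 : ∫⁻ t in K, (ω t : ℝ≥0∞) ∂leb ≤ ∫⁻ t in K, ENNReal.ofReal C ∂leb := by
    refine setLIntegral_mono measurable_const fun t ht => ?_
    rw [← ENNReal.ofReal_coe_nnreal]
    refine ENNReal.ofReal_le_ofReal ((Real.le_norm_self _).trans (hC t ht))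
  refine (h2.trans_lt ?_).ne
  rw [setLIntegral_const]
  exact ENNReal.mul_lt_top ENNReal.ofReal_lt_top hK.measure_lt_top

end WL1

/-! ### The space `L^∞(1/ω)` -/

namespace WLinf

variable {ω : Weight}

lemma linfENorm_eq (h : WLinf ω) : linfENorm ω h.toClass = ENNReal.ofReal ‖h‖ :=
  (ENNReal.ofReal_toReal h.2.ne).symm

lemma ae_norm_le (h : WLinf ω) : ∀ᵐ t ∂leb, ‖h.toClass t‖ ≤ ‖h‖ * ω t := by
  have h1 := ae_le_eLpNormEssSup (f := fun t => h.toClass t / ((ω t : ℝ) : ℂ)) (μ := leb)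
  rw [← eLpNorm_exponent_top, ← linfENorm, linfENorm_eq] at h1
  filter_upwards [h1] with t ht
  rw [← ofReal_norm, ENNReal.ofReal_le_ofReal_iff (norm_nonneg _), norm_div, Complex.norm_real,
    Real.norm_of_nonneg (NNReal.coe_nonneg _), div_le_iff₀ (NNReal.coe_pos.2 (ω.pos t))] at ht
  exact ht

lemma exists_ae_eq {F : ℝ≥0 → ℂ} (hF : AEStronglyMeasurable F leb) {K : ℝ} (hK : 0 ≤ K)
    (hb : ∀ᵐ t ∂leb, ‖F t‖ ≤ K * ω t) :
    ∃ h : WLinf ω, h.toClass =ᵐ[leb] F ∧ ‖h‖ ≤ K := by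
  have hle : linfENorm ω (AEEqFun.mk F hF) ≤ ENNReal.ofReal K := by
    unfold linfENorm
    rw [eLpNorm_exponent_top]
    refine essSup_le_of_ae_le _ ?_
    filter_upwards [hb, AEEqFun.coeFn_mk F hF] with t ht h1
    rw [h1, ← ofReal_norm, norm_div, Complex.norm_real,
      Real.norm_of_nonneg (NNReal.coe_nonneg _)]
    exact ENNReal.ofReal_le_ofReal ((div_le_iff₀ (NNReal.coe_pos.2 (ω.pos t))).2 ht)
  refine ⟨⟨AEEqFun.mk F hF, hle.trans_lt ENNReal.ofReal_lt_top⟩, AEEqFun.coeFn_mk F hF, ?_⟩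
  exact ENNReal.toReal_le_of_le_ofReal hK hle

lemma ext_ae {h k : WLinf ω} (hk : h.toClass =ᵐ[leb] k.toClass) : h = k :=
  Subtype.ext (AEEqFun.ext hk)

lemma coeFn_add (h k : WLinf ω) :
    ∀ᵐ t ∂leb, (h + k).toClass t = h.toClass t + k.toClass t :=
  AEEqFun.coeFn_add h.toClass k.toClass

lemma coeFn_smul (c : ℂ) (h : WLinf ω) : ∀ᵐ t ∂leb, (c • h).toClass t = c * h.toClass t :=
  AEEqFun.coeFn_smul c h.toClass

lemma measurable (h : WLinf ω) : Measurable h.toClass :=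
  (AEEqFun.stronglyMeasurable h.toClass).measurable

end WLinf

/-! ### The duality between `L¹(ω)` and `L^∞(1/ω)` -/

section pairL

variable {ω : Weight}

/-- Functions that are dominated by a weight are integrable against densities in its dual space. -/
lemma integrable_mul_of_le {X : Type*} [MeasurableSpace X] {P : Measure X} {w : X → ℝ≥0}
    {G u : X → ℂ} {K : ℝ} (hG : AEStronglyMeasurable G P) (hu : AEStronglyMeasurable u P)
    (hle : ∀ᵐ x ∂P, ‖G x‖ ≤ K * w x) (hfin : ∫⁻ x, w x * ‖u x‖ₑ ∂P ≠ ∞) :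
    Integrable (fun x => G x * u x) P := by
  refine ⟨hG.mul hu, ?_⟩
  rw [HasFiniteIntegral]
  have h1 : ∫⁻ x, ‖G x * u x‖ₑ ∂P ≤ ∫⁻ x, ENNReal.ofReal K * (w x * ‖u x‖ₑ) ∂P := by
    refine lintegral_mono_ae ?_
    filter_upwards [hle] with x hx
    rw [enorm_mul, ← mul_assoc]
    gcongr
    rw [← ofReal_norm, ← ENNReal.ofReal_coe_nnreal, ← ENNReal.ofReal_mul' (NNReal.coe_nonneg _)]
    exact ENNReal.ofReal_le_ofReal hx
  refine h1.trans_lt ?_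
  rw [lintegral_const_mul' _ _ ENNReal.ofReal_ne_top]
  exact ENNReal.mul_lt_top ENNReal.ofReal_lt_top hfin.lt_top

lemma integrable_pairL (f : WL1 ω) (h : WLinf ω) :
    Integrable (fun t => f t * h.toClass t) leb := by
  refine (integrable_mul_of_le (AEEqFun.aestronglyMeasurable _)
    f.measurable.aestronglyMeasurable h.ae_norm_le f.lintegral_enorm_ne_top).congr ?_
  filter_upwards with t using mul_comm _ _

lemma pairL_add_right (f : WL1 ω) (h k : WLinf ω) : pairL f (h + k) = pairL f h + pairL f k := by
  unfold pairL
  rw [← integral_add (integrable_pairL f h) (integrable_pairL f k)]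
  refine integral_congr_ae ?_
  filter_upwards [h.coeFn_add k] with t ht
  rw [ht, mul_add]

lemma pairL_smul_right (c : ℂ) (f : WL1 ω) (h : WLinf ω) : pairL f (c • h) = c * pairL f h := by
  unfold pairL
  rw [← integral_const_mul]
  refine integral_congr_ae ?_
  filter_upwards [h.coeFn_smul c] with t ht
  rw [ht, mul_left_comm]

lemma WLinf.locallyIntegrable (h : WLinf ω) : LocallyIntegrable h.toClass leb := by
  rw [locallyIntegrable_iff]
  intro K hK
  obtain ⟨f, hf⟩ := WL1.exists_ae_eq_indicator ω hK
  rw [← integrable_indicator_iff hK.measurableSet]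
  refine (integrable_pairL f h).congr ?_
  filter_upwards [hf] with t ht
  by_cases htK : t ∈ K <;> simp [ht, htK]

/-- Indicators of compact sets lie in L¹(ω), and a locally integrable function is determined almost
everywhere by its integrals over compact sets. -/
lemma eq_of_pairL_eq {h k : WLinf ω} (hk : ∀ f : WL1 ω, pairL f h = pairL f k) : h = k := by
  apply WLinf.ext_ae
  have h0 := ae_eq_zero_of_forall_setIntegral_isCompact_eq_zero'
    (h.locallyIntegrable.sub k.locallyIntegrable) fun K hK => ?_
  · filter_upwards [h0] with t ht
    exact sub_eq_zero.1 ht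
  · obtain ⟨f, hf⟩ := WL1.exists_ae_eq_indicator ω hK
    have key : ∀ h : WLinf ω, ∫ t in K, h.toClass t ∂leb = pairL f h := by
      intro h
      rw [← integral_indicator hK.measurableSet]
      refine integral_congr_ae ?_
      filter_upwards [hf] with t ht
      by_cases htK : t ∈ K <;> simp [ht, htK]
    simp only [Pi.sub_apply]
    rw [integral_sub (h.locallyIntegrable.integrableOn_isCompact hK)
      (k.locallyIntegrable.integrableOn_isCompact hK), key, key, hk, sub_self]

end pairL

/-! ### The space `C₀(ω)` -/

namespace WC0

variable {ω : Weight}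

lemma continuous (g : WC0 ω) : Continuous g := g.1.continuous

lemma norm_apply_le (g : WC0 ω) (t : ℝ≥0) : ‖g t‖ ≤ ‖g‖ * ω t := by
  have h : ‖g t / ((ω t : ℝ) : ℂ)‖ ≤ ‖g‖ :=
    BoundedContinuousFunction.norm_coe_le_norm (WC0.divWeight ω g).toBCF t
  rwa [norm_div, Complex.norm_real, Real.norm_of_nonneg (NNReal.coe_nonneg _),
    div_le_iff₀ (NNReal.coe_pos.2 (ω.pos t))] at h

lemma norm_le {g : WC0 ω} {K : ℝ} (hK : 0 ≤ K) (h : ∀ t, ‖g t‖ ≤ K * ω t) : ‖g‖ ≤ K := by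
  refine (BoundedContinuousFunction.norm_le (f := (WC0.divWeight ω g).toBCF) hK).2 fun t => ?_
  change ‖g t / ((ω t : ℝ) : ℂ)‖ ≤ K
  rw [norm_div, Complex.norm_real, Real.norm_of_nonneg (NNReal.coe_nonneg _),
    div_le_iff₀ (NNReal.coe_pos.2 (ω.pos t))]
  exact h t

lemma exists_eq_of_hasCompactSupport (ω : Weight) {F : ℝ≥0 → ℂ} (hF : Continuous F)
    (hc : HasCompactSupport F) : ∃ g : WC0 ω, ∀ t, g t = F t := by
  refine ⟨⟨⟨F, hF⟩, ?_⟩, fun t => rfl⟩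
  have h1 : HasCompactSupport fun t => F t / ((ω t : ℝ) : ℂ) := by
    simp_rw [div_eq_mul_inv]
    exact hc.mul_right
  have h2 : Continuous fun t => F t / ((ω t : ℝ) : ℂ) :=
    hF.div (Complex.continuous_ofReal.comp (NNReal.continuous_coe.comp ω.continuous_toFun))
      ω.ne_zero
  exact h1.is_zero_at_infty

lemma coeFn_toLinf (g : WC0 ω) : g.toLinf.toClass =ᵐ[leb] g :=
  ContinuousMap.coeFn_toAEEqFun leb g.1

lemma toLinf_injective : Function.Injective (WC0.toLinf (ω := ω)) := by
  intro g k h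
  apply Subtype.ext
  ext t
  have h1 : (g : ℝ≥0 → ℂ) =ᵐ[leb] k := by
    refine (coeFn_toLinf g).symm.trans ?_
    rw [h]
    exact coeFn_toLinf k
  exact congrFun ((g.continuous.ae_eq_iff_eq leb k.continuous).1 h1) t

lemma toLinf_add (g k : WC0 ω) : (g + k).toLinf = g.toLinf + k.toLinf := by
  apply WLinf.ext_ae
  filter_upwards [coeFn_toLinf (g + k), coeFn_toLinf g, coeFn_toLinf k,
    WLinf.coeFn_add g.toLinf k.toLinf] with t h1 h2 h3 h4
  rw [h1, h4, h2, h3]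
  rfl

lemma toLinf_smul (c : ℂ) (g : WC0 ω) : (c • g).toLinf = c • g.toLinf := by
  apply WLinf.ext_ae
  filter_upwards [coeFn_toLinf (c • g), coeFn_toLinf g, WLinf.coeFn_smul c g.toLinf]
    with t h1 h2 h3
  rw [h1, h3, h2]
  rfl

end WC0

/-! ### The duality between `C₀(ω)` and `M(ω)` -/

section pairM

variable {ω : Weight}

lemma Represents.integrable {X : Type*} [MeasurableSpace X] {P : Measure X} {φ : X → ℝ≥0}
    {u : X → ℂ} {μ : LocMeasure} (h : Represents P φ u μ)
    (hfin : ∫⁻ x, ω (φ x) * ‖u x‖ₑ ∂P ≠ ∞) (g : WC0 ω) :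
    Integrable (fun x => g (φ x) * u x) P :=
  integrable_mul_of_le (w := fun x => ω (φ x))
    (g.continuous.measurable.comp h.measurable).aestronglyMeasurable h.aestronglyMeasurable
    (Filter.Eventually.of_forall fun x => g.norm_apply_le (φ x)) hfin

lemma pairM_eq_integral {X : Type*} [MeasurableSpace X] {P : Measure X} {φ : X → ℝ≥0}
    {u : X → ℂ} {μ : WM ω} (h : Represents P φ u μ.toLoc)
    (hfin : ∫⁻ x, ω (φ x) * ‖u x‖ₑ ∂P ≠ ∞) (g : WC0 ω) :
    pairM g μ = ∫ x, g (φ x) * u x ∂P :=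
  h.integral_eq g.continuous.measurable (h.integrable hfin g)

lemma WM.lintegral_ne_top {μ : WM ω} {m : Measure ℝ≥0} {u : ℝ≥0 → ℂ}
    (h : Represents m id u μ.toLoc) : ∫⁻ t, ω (id t) * ‖u t‖ₑ ∂m ≠ ∞ := by
  have h1 : mENorm ω μ.toLoc < ∞ := μ.2
  rw [h.mENorm_eq] at h1
  exact h1.ne

lemma integrable_part (μ : WM ω) (g : WC0 ω) (n : ℕ) : (μ.toLoc.part n).Integrable g := by
  unfold VectorMeasure.Integrable
  refine ⟨g.continuous.measurable.aestronglyMeasurable, ?_⟩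
  have h1 : ∫⁻ t, (ω t : ℝ≥0∞) ∂(μ.toLoc.part n).variation ≤ mENorm ω μ.toLoc :=
    lintegral_mono' (Measure.le_sum _ n) le_rfl
  have h2 : ∫⁻ t, ‖g t‖ₑ ∂(μ.toLoc.part n).variation
      ≤ ∫⁻ t, ENNReal.ofReal ‖g‖ * (ω t : ℝ≥0∞) ∂(μ.toLoc.part n).variation := by
    refine lintegral_mono fun t => ?_
    rw [← ofReal_norm, ← ENNReal.ofReal_coe_nnreal, ← ENNReal.ofReal_mul (norm_nonneg _)]
    exact ENNReal.ofReal_le_ofReal (g.norm_apply_le t)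
  refine h2.trans_lt ?_
  rw [lintegral_const_mul' _ _ ENNReal.ofReal_ne_top]
  exact ENNReal.mul_lt_top ENNReal.ofReal_lt_top (h1.trans_lt μ.2)

/-- The integral against μ is defined by `tsum`, whose default value is 0; additivity in μ therefore
needs actual convergence, which the polar decomposition supplies. -/
lemma hasSum_pairM (g : WC0 ω) (μ : WM ω) :
    HasSum (fun n => VectorMeasure.integral (μ.toLoc.part n) g (ContinuousLinearMap.mul ℝ ℂ))
      (pairM g μ) := by
  obtain ⟨u, hu⟩ := μ.exists_represents_id
  have hfin := WM.lintegral_ne_top hu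
  rw [pairM_eq_integral hu hfin]
  exact hu.hasSum_integral g.continuous.measurable (hu.integrable hfin g)

lemma pairM_add_right (g : WC0 ω) (μ ν : WM ω) : pairM g (μ + ν) = pairM g μ + pairM g ν := by
  refine (hasSum_pairM g (μ + ν)).unique (((hasSum_pairM g μ).add (hasSum_pairM g ν)).congr_fun
    fun n => ?_)
  have : (μ + ν).toLoc.part n = μ.toLoc.part n + ν.toLoc.part n := LocMeasure.part_add n _ _
  rw [this, VectorMeasure.integral_add_vectorMeasure (integrable_part μ g n)
    (integrable_part ν g n)]

lemma Represents.smul {m : Measure ℝ≥0} {u : ℝ≥0 → ℂ} {μ : LocMeasure}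
    (h : Represents m id u μ) (c : ℂ) : Represents m id (c • u) (c • μ) where
  measurable := measurable_id
  integrableOn n := (h.integrableOn n).smul c
  part_eq n := by
    rw [LocMeasure.part_smul, h.part_eq n, VectorMeasure.map_id, VectorMeasure.map_id,
      withDensityᵥ_smul]

lemma pairM_smul_right (c : ℂ) (g : WC0 ω) (μ : WM ω) : pairM g (c • μ) = c * pairM g μ := by
  obtain ⟨u, hu⟩ := μ.exists_represents_id
  have hc : Represents _ id (c • u) (c • μ).toLoc := hu.smul c
  rw [pairM_eq_integral hu (WM.lintegral_ne_top hu),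
    pairM_eq_integral hc (WM.lintegral_ne_top hc), ← integral_const_mul]
  refine integral_congr_ae (Filter.Eventually.of_forall fun t => ?_)
  simp [mul_left_comm]

lemma WM.locallyIntegrable {μ : WM ω} {m : Measure ℝ≥0} {u : ℝ≥0 → ℂ}
    (h : Represents m id u μ.toLoc) : LocallyIntegrable u m := by
  rw [locallyIntegrable_iff]
  intro K hK
  obtain ⟨c, hc, hcK⟩ := ω.exists_le hK.isBounded
  have h1 : ∫⁻ t in K, ω t * ‖u t‖ₑ ∂m ≠ ∞ :=
    ne_top_of_le_ne_top (WM.lintegral_ne_top h) (setLIntegral_le_lintegral _ _)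
  -- On K the constant 1 is dominated by c⁻¹ ω, where c is a lower bound of ω there.
  have h2 := integrable_mul_of_le (G := fun _ => 1) (K := c⁻¹) (w := ω) (P := m.restrict K)
    aestronglyMeasurable_const h.aestronglyMeasurable.restrict ?_ h1
  · simp only [one_mul] at h2
    exact h2
  · filter_upwards [ae_restrict_mem hK.measurableSet] with t ht
    rw [norm_one, ← div_eq_inv_mul, one_le_div (NNReal.coe_pos.2 hc)]
    exact NNReal.coe_le_coe.2 (hcK t ht)

/-- In the polar form u d|μ|, continuous cutoffs of a compact set K decrease to its indicator, so
∫_K u d|μ| = 0 for every compact K. Hence u = 0 almost everywhere for |μ|, and the norm of μ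
vanishes. -/
lemma eq_zero_of_pairM_eq_zero {μ : WM ω} (hμ : ∀ g : WC0 ω, pairM g μ = 0) : μ = 0 := by
  obtain ⟨u, hu⟩ := μ.exists_represents_id
  have hfin := WM.lintegral_ne_top hu
  have hu0 : u =ᵐ[μ.toLoc.tv] 0 := by
    refine ae_eq_zero_of_forall_setIntegral_isCompact_eq_zero' (WM.locallyIntegrable hu)
      fun K hK => ?_
    have hpos : ∀ n : ℕ, (0 : ℝ) < 1 / (n + 1) := fun n => Nat.one_div_pos_of_nat
    have hcont : ∀ n : ℕ, Continuous fun t => ((thickenedIndicator (hpos n) K t : ℝ) : ℂ) :=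
      fun n => Complex.continuous_ofReal.comp
        (NNReal.continuous_coe.comp (thickenedIndicator (hpos n) K).continuous)
    have hsupp : ∀ n : ℕ, HasCompactSupport
        fun t => ((thickenedIndicator (hpos n) K t : ℝ) : ℂ) := by
      intro n
      refine HasCompactSupport.intro (hK.cthickening (r := 1 / ((n : ℝ) + 1))) fun t ht => ?_
      rw [thickenedIndicator_zero (hpos n) K fun h' => ht (Metric.thickening_subset_cthickening _ _ h')]
      simp
    choose θ hθ using fun n => WC0.exists_eq_of_hasCompactSupport ω (hcont n) (hsupp n)
    have hlim : Filter.Tendsto (fun n => ∫ t, θ n t * u t ∂μ.toLoc.tv) Filter.atTop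
        (nhds (∫ t, K.indicator u t ∂μ.toLoc.tv)) := by
      -- The cutoffs decrease with n, so the integrand for n = 0 dominates all of them.
      refine tendsto_integral_of_dominated_convergence (fun t => ‖θ 0 t * u t‖)
        (fun n => (hu.integrable hfin (θ n)).aestronglyMeasurable)
        (hu.integrable hfin (θ 0)).norm (fun n => Filter.Eventually.of_forall fun t => ?_)
        (Filter.Eventually.of_forall fun t => ?_)
      · rw [norm_mul, norm_mul, hθ, hθ, Complex.norm_real, Complex.norm_real, NNReal.norm_eq,
          NNReal.norm_eq]
        gcongr
        refine thickenedIndicator_mono _ _ ?_ K t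
        exact one_div_le_one_div_of_le (by simp) (by simp)
      · have h1 := (tendsto_pi_nhds.1 (thickenedIndicator_tendsto_indicator_closure hpos
          tendsto_one_div_add_atTop_nhds_zero_nat K)) t
        have h2 := ((Complex.continuous_ofReal.comp NNReal.continuous_coe).tendsto _).comp h1
        have h3 := h2.mul_const (u t)
        rw [hK.isClosed.closure_eq] at h3
        simp only [hθ]
        have h4 : K.indicator u t = (Complex.ofReal ∘ NNReal.toReal)
            (K.indicator (fun _ => 1) t) * u t := by
          by_cases ht : t ∈ K <;> simp [ht]
        rw [h4]
        exact h3
    have hz : ∀ n, ∫ t, θ n t * u t ∂μ.toLoc.tv = 0 := fun n =>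
      (pairM_eq_integral hu hfin (θ n)).symm.trans (hμ _)
    simp only [hz] at hlim
    rw [← integral_indicator hK.measurableSet]
    exact (tendsto_nhds_unique tendsto_const_nhds hlim).symm
  have h0 : mENorm ω μ.toLoc = 0 := by
    rw [hu.mENorm_eq, lintegral_eq_zero_of_ae_eq_zero]
    filter_upwards [hu0] with t ht
    simp [ht]
  exact Subtype.ext ((mENorm_eq_zero ω _).1 h0)

lemma eq_of_pairM_eq {μ ν : WM ω} (h : ∀ g : WC0 ω, pairM g μ = pairM g ν) : μ = ν := by
  have h1 : μ + (-1 : ℂ) • ν = 0 := eq_zero_of_pairM_eq_zero fun g => by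
    rw [pairM_add_right, pairM_smul_right, h]
    ring
  rwa [neg_smul, one_smul, ← sub_eq_add_neg, sub_eq_zero] at h1

lemma pairM_toM (g : WC0 ω) (f : WL1 ω) : pairM g f.toM = pairL f g.toLinf := by
  have h : Represents leb id f f.toM.toLoc := f.represents
  rw [pairM_eq_integral h f.lintegral_enorm_ne_top, pairL]
  refine integral_congr_ae ?_
  filter_upwards [g.coeFn_toLinf] with t ht
  rw [ht, mul_comm]
  rfl

end pairM

/-! ### Dilation kernels -/

/-- A measure on `[0, 1]` without mass at `0` that satisfies the integral form of condition (C). -/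
structure IsDilationKernel (κ : Measure ℝ≥0) (C : ℝ≥0) (ω₁ ω₂ : Weight) : Prop where
  ae_ne_zero : ∀ᵐ t ∂κ, t ≠ 0
  ae_le_one : ∀ᵐ t ∂κ, t ≤ 1
  lintegral_le : ∀ s, ∫⁻ t, (ω₂ (s / t) : ℝ≥0∞) ∂κ ≤ C * ω₁ s

/-- The measure `ψ(t)/t dt` on `[0, 1]`. -/
def dilationKernel (ψ : ℝ≥0 → ℝ≥0) : Measure ℝ≥0 :=
  (leb.restrict (Icc 0 1)).withDensity fun t => ((ψ t / t : ℝ≥0) : ℝ≥0∞)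

section kernel

variable {ψ : ℝ≥0 → ℝ≥0}

lemma aemeasurable_div_id (hψ : AEMeasurable ψ (leb.restrict (Icc 0 1))) :
    AEMeasurable (fun t => ψ t / t) (leb.restrict (Icc 0 1)) :=
  hψ.div aemeasurable_id

lemma ae_ne_zero_leb : ∀ᵐ t ∂leb, t ≠ 0 := by
  rw [ae_iff]
  simp

/-- The factor t cancels the 1/t of the kernel except at t = 0, where division gives 0; that point
is null. -/
lemma smul_div_mul_ae_eq (F : ℝ≥0 → ℂ) :
    (fun t => (ψ t / t) • (F t * ((t : ℝ) : ℂ))) =ᵐ[leb.restrict (Icc 0 1)]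
      fun t => F t * ((ψ t : ℝ) : ℂ) := by
  filter_upwards [ae_restrict_of_ae ae_ne_zero_leb] with t ht
  have ht' : ((t : ℝ) : ℂ) ≠ 0 := by exact_mod_cast ht
  rw [NNReal.smul_def, Complex.real_smul]
  push_cast
  field_simp

lemma integrable_dilationKernel_iff (hψ : AEMeasurable ψ (leb.restrict (Icc 0 1)))
    (F : ℝ≥0 → ℂ) : Integrable (fun t => F t * ((t : ℝ) : ℂ)) (dilationKernel ψ) ↔
      IntegrableOn (fun t => F t * ((ψ t : ℝ) : ℂ)) (Icc 0 1) leb := by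
  rw [dilationKernel, integrable_withDensity_iff_integrable_smul₀ (aemeasurable_div_id hψ)]
  exact integrable_congr (smul_div_mul_ae_eq F)

lemma integral_dilationKernel (hψ : AEMeasurable ψ (leb.restrict (Icc 0 1))) (F : ℝ≥0 → ℂ) :
    ∫ t, F t * ((t : ℝ) : ℂ) ∂(dilationKernel ψ)
      = ∫ t in Icc 0 1, F t * ((ψ t : ℝ) : ℂ) ∂leb := by
  rw [dilationKernel, integral_withDensity_eq_integral_smul₀ (aemeasurable_div_id hψ)]
  exact integral_congr_ae (smul_div_mul_ae_eq F)

lemma ConditionC.exists_isDilationKernel (hψ : AEMeasurable ψ (leb.restrict (Icc 0 1)))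
    {ω₁ ω₂ : Weight} (hC : ConditionC ψ ω₁ ω₂) :
    ∃ C, IsDilationKernel (dilationKernel ψ) C ω₁ ω₂ := by
  obtain ⟨C, hC⟩ := hC
  have hac := withDensity_absolutelyContinuous (leb.restrict (Icc 0 1))
    (fun t => ((ψ t / t : ℝ≥0) : ℝ≥0∞))
  refine ⟨C, hac.ae_le (ae_restrict_of_ae ae_ne_zero_leb), hac.ae_le ?_, fun s => ?_⟩
  · filter_upwards [ae_restrict_mem measurableSet_Icc] with t ht using ht.2
  · have hm : Measurable fun t : ℝ≥0 => (ω₂ (s / t) : ℝ≥0∞) :=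
      (ω₂.measurable.comp (measurable_const.div measurable_id)).coe_nnreal_ennreal
    rw [dilationKernel, lintegral_withDensity_eq_lintegral_mul₀
      (aemeasurable_div_id hψ).coe_nnreal_ennreal hm.aemeasurable]
    refine le_trans (le_of_eq (lintegral_congr fun t => ?_)) ((hC s).trans_eq ?_)
    · simp only [Pi.mul_apply]
      rw [mul_comm, ← ENNReal.coe_mul]
    · push_cast
      rfl

end kernel

namespace IsDilationKernel

variable {κ : Measure ℝ≥0} {C : ℝ≥0} {ω₁ ω₂ : Weight}

/-- At s = 0 the integrand of (C) is the constant ω₂(0) > 0. -/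
lemma isFiniteMeasure (hκ : IsDilationKernel κ C ω₁ ω₂) : IsFiniteMeasure κ := by
  refine ⟨?_⟩
  have h := hκ.lintegral_le 0
  simp only [zero_div, lintegral_const] at h
  by_contra h'
  rw [not_lt, top_le_iff] at h'
  rw [h', ENNReal.mul_top (by exact_mod_cast (ω₂.pos 0).ne'), top_le_iff] at h
  exact ENNReal.mul_ne_top ENNReal.coe_ne_top ENNReal.coe_ne_top h

/-- For t ≠ 0 the dilation by t pulls null sets back to null sets, and Fubini exchanges the two
quantifiers; a measurable hull of the exceptional set makes Fubini applicable. This is why the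
formula for U does not depend on representatives. -/
lemma ae_ae_mul [SFinite κ] (hκ : IsDilationKernel κ C ω₁ ω₂) {p : ℝ≥0 → Prop}
    (hp : ∀ᵐ s ∂leb, p s) : ∀ᵐ x ∂leb, ∀ᵐ t ∂κ, p (t * x) := by
  let N := toMeasurable leb {s | ¬ p s}
  have hN : leb N = 0 := (measure_toMeasurable _).trans hp
  have hNm : MeasurableSet N := measurableSet_toMeasurable _ _
  have h1 : ∀ᵐ x ∂leb, ∀ᵐ t ∂κ, t * x ∉ N := by
    have hm : Measurable fun q : ℝ≥0 × ℝ≥0 => q.2 * q.1 := by fun_prop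
    rw [Measure.ae_ae_comm (p := fun x t => t * x ∉ N) (hm hNm.compl)]
    filter_upwards [hκ.ae_ne_zero] with t ht
    rw [ae_iff]
    simp only [not_not]
    exact (leb_preimage_mul_left ht N).trans (by rw [hN, mul_zero])
  filter_upwards [h1] with x hx
  filter_upwards [hx] with t ht
  by_contra h
  exact ht (subset_toMeasurable _ _ h)

lemma ae_ae_div [SFinite κ] (hκ : IsDilationKernel κ C ω₁ ω₂) {p : ℝ≥0 → Prop}
    (hp : ∀ᵐ s ∂leb, p s) : ∀ᵐ s ∂leb, ∀ᵐ t ∂κ, p (s / t) := by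
  let N := toMeasurable leb {s | ¬ p s}
  have hN : leb N = 0 := (measure_toMeasurable _).trans hp
  have hNm : MeasurableSet N := measurableSet_toMeasurable _ _
  have h1 : ∀ᵐ s ∂leb, ∀ᵐ t ∂κ, s / t ∉ N := by
    have hm : Measurable fun q : ℝ≥0 × ℝ≥0 => q.1 / q.2 := by fun_prop
    rw [Measure.ae_ae_comm (p := fun s t => s / t ∉ N) (hm hNm.compl)]
    filter_upwards [hκ.ae_ne_zero] with t ht
    rw [ae_iff]
    simp only [not_not, div_eq_inv_mul]
    exact (leb_preimage_mul_left (inv_ne_zero ht) N).trans (by rw [hN, mul_zero])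
  filter_upwards [h1] with x hx
  filter_upwards [hx] with t ht
  by_contra h
  exact ht (subset_toMeasurable _ _ h)

/-- The basic estimate: integrate over t first and apply (C). The measure m is left general because
both Lebesgue measure and |μ| are needed. -/
lemma lintegral_prod_le [SFinite κ] (hκ : IsDilationKernel κ C ω₁ ω₂) {m : Measure ℝ≥0}
    [SFinite m] {u : ℝ≥0 → ℂ} (hu : AEStronglyMeasurable u m) :
    ∫⁻ p, ω₂ (p.1 / p.2) * ‖u p.1‖ₑ ∂(m.prod κ) ≤ C * ∫⁻ s, ω₁ s * ‖u s‖ₑ ∂m := by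
  have hω : Measurable fun p : ℝ≥0 × ℝ≥0 => (ω₂ (p.1 / p.2) : ℝ≥0∞) :=
    (ω₂.measurable.comp (measurable_fst.div measurable_snd)).coe_nnreal_ennreal
  have hm : AEMeasurable (fun p : ℝ≥0 × ℝ≥0 => (ω₂ (p.1 / p.2) : ℝ≥0∞) * ‖u p.1‖ₑ) (m.prod κ) :=
    hω.aemeasurable.mul hu.comp_fst.enorm
  rw [lintegral_prod _ hm,
    ← lintegral_const_mul' _ _ ENNReal.coe_ne_top]
  refine lintegral_mono fun s => ?_
  dsimp only
  rw [lintegral_mul_const' _ _ enorm_ne_top, ← mul_assoc]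
  gcongr
  exact hκ.lintegral_le s

/-- For fixed t ≠ 0 the substitution s = tx absorbs the factor t and turns ω₂(x) into ω₂(s/t), which
is the basic estimate for Lebesgue measure. -/
lemma lintegral_mul_prod_le [SFinite κ] (hκ : IsDilationKernel κ C ω₁ ω₂) {f : ℝ≥0 → ℂ}
    (hf : Measurable f) :
    ∫⁻ p, ω₂ p.1 * ‖f (p.2 * p.1) * ((p.2 : ℝ) : ℂ)‖ₑ ∂(leb.prod κ)
      ≤ C * ∫⁻ s, ω₁ s * ‖f s‖ₑ ∂leb := by
  refine le_trans (le_of_eq ?_) (hκ.lintegral_prod_le hf.aestronglyMeasurable)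
  have hω := ω₂.measurable
  have hm1 : Measurable fun p : ℝ≥0 × ℝ≥0 =>
      (ω₂ p.1 : ℝ≥0∞) * ‖f (p.2 * p.1) * ((p.2 : ℝ) : ℂ)‖ₑ := by fun_prop
  have hm2 : Measurable fun p : ℝ≥0 × ℝ≥0 => (ω₂ (p.1 / p.2) : ℝ≥0∞) * ‖f p.1‖ₑ := by fun_prop
  rw [lintegral_prod_symm _ hm1.aemeasurable,
    lintegral_prod_symm _ hm2.aemeasurable]
  refine lintegral_congr_ae ?_
  filter_upwards [hκ.ae_ne_zero] with t ht
  have hm3 : Measurable fun s => (ω₂ (s / t) : ℝ≥0∞) * ‖f s‖ₑ := by fun_prop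
  rw [← lintegral_comp_mul_left ht hm3]
  refine lintegral_congr fun x => ?_
  have h1 : ‖((t : ℝ) : ℂ)‖ₑ = t := by
    rw [← ofReal_norm, Complex.norm_real, NNReal.norm_eq, ENNReal.ofReal_coe_nnreal]
  rw [mul_div_cancel_left₀ _ ht, enorm_mul, h1]
  ring

end IsDilationKernel

namespace IsDilationKernel

variable {κ : Measure ℝ≥0} {C : ℝ≥0} {ω₁ ω₂ : Weight}

/-! ### The operator on `L¹` -/

/-- `y(x) = ∫ f(t x) t dκ(t)` for almost every `x`. -/
def DilationEq (κ : Measure ℝ≥0) (f : WL1 ω₁) (y : WL1 ω₂) : Prop :=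
  ∀ᵐ x ∂leb, Integrable (fun t => f (t * x) * ((t : ℝ) : ℂ)) κ ∧
    y x = ∫ t, f (t * x) * ((t : ℝ) : ℂ) ∂κ

lemma integrable_mul_comp [SFinite κ] (hκ : IsDilationKernel κ C ω₁ ω₂) (f : WL1 ω₁)
    {h : ℝ≥0 → ℂ} (hm : Measurable h) {K : ℝ} (hh : ∀ᵐ x ∂leb, ‖h x‖ ≤ K * ω₂ x) :
    Integrable (fun p : ℝ≥0 × ℝ≥0 => h p.1 * (f (p.2 * p.1) * ((p.2 : ℝ) : ℂ)))
      (leb.prod κ) := by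
  have hf := f.measurable
  have hω := ω₂.measurable
  have hm1 : Measurable fun p : ℝ≥0 × ℝ≥0 => f (p.2 * p.1) * ((p.2 : ℝ) : ℂ) := by fun_prop
  have hm2 : Measurable fun p : ℝ≥0 × ℝ≥0 => h p.1 := by fun_prop
  refine integrable_mul_of_le (K := K) (w := fun p : ℝ≥0 × ℝ≥0 => ω₂ p.1)
    hm2.aestronglyMeasurable hm1.aestronglyMeasurable ?_ ?_
  · exact Measure.quasiMeasurePreserving_fst.ae hh
  · exact ne_top_of_le_ne_top (ENNReal.mul_ne_top ENNReal.coe_ne_top f.lintegral_enorm_ne_top)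
      (hκ.lintegral_mul_prod_le hf)

lemma exists_dilationEq [SFinite κ] (hκ : IsDilationKernel κ C ω₁ ω₂) (f : WL1 ω₁) :
    ∃ y : WL1 ω₂, DilationEq κ f y ∧ ‖y‖ ≤ C * ‖f‖ := by
  have hf := f.measurable
  have hm1 : Measurable fun p : ℝ≥0 × ℝ≥0 => f (p.2 * p.1) * ((p.2 : ℝ) : ℂ) := by fun_prop
  have hF : StronglyMeasurable fun x => ∫ t, f (t * x) * ((t : ℝ) : ℂ) ∂κ :=
    hm1.stronglyMeasurable.integral_prod_right'
  have hle : ∫⁻ x, ω₂ x * ‖∫ t, f (t * x) * ((t : ℝ) : ℂ) ∂κ‖ₑ ∂leb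
      ≤ ENNReal.ofReal (C * ‖f‖) := by
    rw [ENNReal.ofReal_mul (NNReal.coe_nonneg C), ENNReal.ofReal_coe_nnreal, ← f.lintegral_enorm]
    refine le_trans ?_ (hκ.lintegral_mul_prod_le hf)
    have hω := ω₂.measurable
    have hm2 : Measurable fun p : ℝ≥0 × ℝ≥0 =>
      (ω₂ p.1 : ℝ≥0∞) * ‖f (p.2 * p.1) * ((p.2 : ℝ) : ℂ)‖ₑ := by fun_prop
    rw [lintegral_prod _ hm2.aemeasurable]
    refine lintegral_mono fun x => ?_
    dsimp only
    rw [lintegral_const_mul' _ _ ENNReal.coe_ne_top]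
    gcongr
    exact enorm_integral_le_lintegral_enorm _
  obtain ⟨y, hy⟩ := WL1.exists_ae_eq (ω := ω₂) hF.aestronglyMeasurable
    (ne_top_of_le_ne_top ENNReal.ofReal_ne_top hle)
  refine ⟨y, ?_, WL1.norm_le_of_lintegral_le (by positivity) (le_trans (le_of_eq ?_) hle)⟩
  -- Fubini is applied with the weight ω₂ itself as multiplier; on almost every slice the nonzero
  -- constant ω₂(x) is then divided out.
  · have h1 : ∀ᵐ x ∂leb, ‖((ω₂ x : ℝ) : ℂ)‖ ≤ 1 * ω₂ x :=
      Filter.Eventually.of_forall fun x => by simp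
    have hω : Measurable fun x => ((ω₂ x : ℝ) : ℂ) :=
      Complex.measurable_ofReal.comp (measurable_coe_nnreal_real.comp ω₂.measurable)
    filter_upwards [hy, (hκ.integrable_mul_comp f hω h1).prod_right_ae] with x hx hi
    refine ⟨?_, hx⟩
    simpa [ω₂.ne_zero x] using hi.const_mul (((ω₂ x : ℝ) : ℂ)⁻¹)
  · refine lintegral_congr_ae ?_
    filter_upwards [hy] with x hx
    rw [hx]

lemma DilationEq.unique {f : WL1 ω₁} {y z : WL1 ω₂} (hy : DilationEq κ f y)
    (hz : DilationEq κ f z) : y = z := by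
  apply WL1.ext_leb
  filter_upwards [hy, hz] with x h1 h2
  rw [h1.2, h2.2]

lemma DilationEq.add [SFinite κ] (hκ : IsDilationKernel κ C ω₁ ω₂) {f f' : WL1 ω₁}
    {y y' : WL1 ω₂} (h : DilationEq κ f y) (h' : DilationEq κ f' y') :
    DilationEq κ (f + f') (y + y') := by
  filter_upwards [h, h', WL1.coeFn_add y y', hκ.ae_ae_mul (WL1.coeFn_add f f')] with x h1 h2 h3 h4
  have h5 : (fun t => (f + f') (t * x) * ((t : ℝ) : ℂ)) =ᵐ[κ]
      fun t => f (t * x) * ((t : ℝ) : ℂ) + f' (t * x) * ((t : ℝ) : ℂ) := by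
    filter_upwards [h4] with t ht
    rw [ht, add_mul]
  refine ⟨(h1.1.add h2.1).congr h5.symm, ?_⟩
  rw [integral_congr_ae h5, integral_add h1.1 h2.1, h3, h1.2, h2.2]

lemma DilationEq.smul [SFinite κ] (hκ : IsDilationKernel κ C ω₁ ω₂) (c : ℂ) {f : WL1 ω₁}
    {y : WL1 ω₂} (h : DilationEq κ f y) : DilationEq κ (c • f) (c • y) := by
  filter_upwards [h, WL1.coeFn_smul c y, hκ.ae_ae_mul (WL1.coeFn_smul c f)] with x h1 h3 h4
  have h5 : (fun t => (c • f) (t * x) * ((t : ℝ) : ℂ)) =ᵐ[κ]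
      fun t => c * (f (t * x) * ((t : ℝ) : ℂ)) := by
    filter_upwards [h4] with t ht
    rw [ht, mul_assoc]
  refine ⟨(h1.1.const_mul c).congr h5.symm, ?_⟩
  rw [integral_congr_ae h5, integral_const_mul, h3, h1.2]

/-! ### The adjoint operator on `L^∞` -/

lemma integral_comp_mul_left {t : ℝ≥0} (ht : t ≠ 0) {F : ℝ≥0 → ℂ} (hF : Measurable F) :
    ∫ x, ((t : ℝ) : ℂ) * F (t * x) ∂leb = ∫ s, F s ∂leb := by
  rw [integral_const_mul, ← integral_map (measurable_const_mul t).aemeasurable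
    hF.aestronglyMeasurable, map_mul_left_leb ht, integral_smul_nnreal_measure, NNReal.smul_def,
    Complex.real_smul, ← mul_assoc]
  have : ((t : ℝ) : ℂ) ≠ 0 := by exact_mod_cast ht
  rw [NNReal.coe_inv, Complex.ofReal_inv, mul_inv_cancel₀ this, one_mul]

lemma integrable_comp_div_mul [SFinite κ] (hκ : IsDilationKernel κ C ω₁ ω₂) (f : WL1 ω₁)
    {h : ℝ≥0 → ℂ} (hm : Measurable h) {K : ℝ} (hh : ∀ᵐ x ∂leb, ‖h x‖ ≤ K * ω₂ x) :
    Integrable (fun p : ℝ≥0 × ℝ≥0 => h (p.1 / p.2) * f p.1) (leb.prod κ) := by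
  have hf := f.measurable
  have hω := ω₂.measurable
  have hm1 : Measurable fun p : ℝ≥0 × ℝ≥0 => f p.1 := by fun_prop
  have hm2 : Measurable fun p : ℝ≥0 × ℝ≥0 => h (p.1 / p.2) := by fun_prop
  refine integrable_mul_of_le (K := K) (w := fun p : ℝ≥0 × ℝ≥0 => ω₂ (p.1 / p.2))
    hm2.aestronglyMeasurable hm1.aestronglyMeasurable ?_ ?_
  · rw [Measure.ae_prod_iff_ae_ae (measurableSet_le (by fun_prop) (by fun_prop))]
    exact hκ.ae_ae_div hh
  · exact ne_top_of_le_ne_top (ENNReal.mul_ne_top ENNReal.coe_ne_top f.lintegral_enorm_ne_top)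
      (hκ.lintegral_prod_le hf.aestronglyMeasurable)

/-- The formula `(U* h)(s) = ∫ h(s/t) dκ(t)` for the adjoint. -/
lemma pairL_eq_of_ae_eq [SFinite κ] (hκ : IsDilationKernel κ C ω₁ ω₂) {f : WL1 ω₁} {y : WL1 ω₂}
    (hy : DilationEq κ f y) (h : WLinf ω₂) {k : WLinf ω₁}
    (hk : ∀ᵐ s ∂leb, k.toClass s = ∫ t, h.toClass (s / t) ∂κ) : pairL f k = pairL y h := by
  have hf := f.measurable
  have hh := h.measurable
  calc pairL f k = ∫ s, ∫ t, h.toClass (s / t) * f s ∂κ ∂leb := by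
        refine integral_congr_ae ?_
        filter_upwards [hk] with s hs
        rw [hs, integral_mul_const, mul_comm]
    _ = ∫ t, ∫ s, h.toClass (s / t) * f s ∂leb ∂κ :=
        integral_integral_swap (hκ.integrable_comp_div_mul f hh h.ae_norm_le)
    -- The substitution s = tx in the inner integral, for t ≠ 0.
    _ = ∫ t, ∫ x, h.toClass x * (f (t * x) * ((t : ℝ) : ℂ)) ∂leb ∂κ := by
        refine integral_congr_ae ?_
        filter_upwards [hκ.ae_ne_zero] with t ht
        have hm : Measurable fun s => h.toClass (s / t) * f s := by fun_prop
        rw [← integral_comp_mul_left ht hm]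
        refine integral_congr_ae (Filter.Eventually.of_forall fun x => ?_)
        dsimp only
        rw [mul_div_cancel_left₀ _ ht]
        ring
    _ = ∫ x, ∫ t, h.toClass x * (f (t * x) * ((t : ℝ) : ℂ)) ∂κ ∂leb :=
        (integral_integral_swap (hκ.integrable_mul_comp f hh h.ae_norm_le)).symm
    _ = pairL y h := by
        refine integral_congr_ae ?_
        filter_upwards [hy] with x hx
        rw [integral_const_mul, ← hx.2, mul_comm]

lemma norm_integral_div_le (hκ : IsDilationKernel κ C ω₁ ω₂) {h : ℝ≥0 → ℂ} {K : ℝ} (hK : 0 ≤ K)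
    {s : ℝ≥0} (hb : ∀ᵐ t ∂κ, ‖h (s / t)‖ ≤ K * ω₂ (s / t)) :
    ‖∫ t, h (s / t) ∂κ‖ ≤ C * K * ω₁ s := by
  have h1 : ‖∫ t, h (s / t) ∂κ‖ₑ ≤ ENNReal.ofReal (C * K * ω₁ s) := by
    refine (enorm_integral_le_lintegral_enorm _).trans ?_
    have h2 : ∫⁻ t, ‖h (s / t)‖ₑ ∂κ ≤ ∫⁻ t, ENNReal.ofReal K * ω₂ (s / t) ∂κ := by
      refine lintegral_mono_ae ?_
      filter_upwards [hb] with t ht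
      rw [← ofReal_norm, ← ENNReal.ofReal_coe_nnreal, ← ENNReal.ofReal_mul hK]
      exact ENNReal.ofReal_le_ofReal ht
    refine h2.trans ?_
    rw [lintegral_const_mul' _ _ ENNReal.ofReal_ne_top]
    refine (mul_le_mul_right (hκ.lintegral_le s) _).trans (le_of_eq ?_)
    rw [mul_comm (C : ℝ), mul_assoc, ENNReal.ofReal_mul hK, ENNReal.ofReal_mul (NNReal.coe_nonneg C),
      ENNReal.ofReal_coe_nnreal, ENNReal.ofReal_coe_nnreal]
  rw [← ofReal_norm] at h1
  exact (ENNReal.ofReal_le_ofReal_iff (by positivity)).1 h1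

lemma exists_adjoint [SFinite κ] (hκ : IsDilationKernel κ C ω₁ ω₂) (h : WLinf ω₂) :
    ∃ k : WLinf ω₁, (∀ᵐ s ∂leb, k.toClass s = ∫ t, h.toClass (s / t) ∂κ) ∧ ‖k‖ ≤ C * ‖h‖ := by
  have hh := h.measurable
  have hm : Measurable fun p : ℝ≥0 × ℝ≥0 => h.toClass (p.1 / p.2) := by fun_prop
  refine WLinf.exists_ae_eq
    (hm.stronglyMeasurable.integral_prod_right' (ν := κ)).aestronglyMeasurable (by positivity) ?_
  filter_upwards [hκ.ae_ae_div h.ae_norm_le] with s hs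
  exact hκ.norm_integral_div_le (norm_nonneg h) hs

end IsDilationKernel

namespace IsDilationKernel

variable {κ : Measure ℝ≥0} {C : ℝ≥0} {ω₁ ω₂ : Weight}

/-! ### The restriction of the adjoint to `C₀` -/

/-- F is bounded and κ is finite, so a constant dominates. The integrand is continuous in s for
every t, including t = 0, where s/t is constantly 0. -/
lemma continuous_integral_div [IsFiniteMeasure κ] {F : ℝ≥0 → ℂ} (hF : Continuous F)
    (hc : HasCompactSupport F) : Continuous fun s => ∫ t, F (s / t) ∂κ := by
  obtain ⟨B, hB⟩ := hF.bounded_above_of_compact_support hc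
  have hm := hF.measurable
  refine continuous_of_dominated (bound := fun _ => B) (fun s => ?_)
    (fun s => Filter.Eventually.of_forall fun t => hB _) (integrable_const _)
    (Filter.Eventually.of_forall fun t => hF.comp (continuous_id.div_const t))
  have : Measurable fun t => F (s / t) := by fun_prop
  exact this.aestronglyMeasurable

/-- Since κ is carried by 0 < t ≤ 1, s/t ≥ s; beyond the support of F the integrand vanishes almost
everywhere. -/
lemma hasCompactSupport_integral_div (hκ : IsDilationKernel κ C ω₁ ω₂) {F : ℝ≥0 → ℂ}
    (hc : HasCompactSupport F) : HasCompactSupport fun s => ∫ t, F (s / t) ∂κ := by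
  obtain ⟨R, hR⟩ := hc.isCompact.bddAbove
  refine HasCompactSupport.intro (isCompact_Icc (a := (0 : ℝ≥0)) (b := R)) fun s hs => ?_
  refine integral_eq_zero_of_ae ?_
  filter_upwards [hκ.ae_ne_zero, hκ.ae_le_one] with t h0 h1
  by_contra h
  have h2 : s / t ≤ R := hR (subset_tsupport _ h)
  refine hs ⟨zero_le, le_trans ?_ h2⟩
  rw [le_div_iff₀ (pos_iff_ne_zero.2 h0)]
  exact mul_le_of_le_one_right zero_le h1

/-- Compactly supported functions are dense in `C₀(ω)`. -/
lemma _root_.HardyCesaro.WC0.exists_hasCompactSupport_norm_sub_le {ω : Weight} (g : WC0 ω) {ε : ℝ}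
    (hε : 0 < ε) : ∃ F : ℝ≥0 → ℂ, Continuous F ∧ HasCompactSupport F ∧
      ∀ t, ‖g t - F t‖ ≤ ε * ω t := by
  have h1 : ∀ᶠ t in Filter.cocompact ℝ≥0, ‖g t / ((ω t : ℝ) : ℂ)‖ < ε := by
    have h2 : Filter.Tendsto (fun t => g t / ((ω t : ℝ) : ℂ)) (Filter.cocompact ℝ≥0) (nhds 0) :=
      g.2
    exact (tendsto_zero_iff_norm_tendsto_zero.1 h2).eventually_lt_const hε
  obtain ⟨K, hK, hKg⟩ := Filter.mem_cocompact.1 h1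
  let χ := thickenedIndicator one_pos K
  have hχ : Continuous fun t => ((χ t : ℝ) : ℂ) :=
    Complex.continuous_ofReal.comp (NNReal.continuous_coe.comp χ.continuous)
  have hsupp : HasCompactSupport fun t => ((χ t : ℝ) : ℂ) := by
    refine HasCompactSupport.intro (hK.cthickening (r := 1)) fun t ht => ?_
    have : χ t = 0 := thickenedIndicator_zero one_pos K
      fun h' => ht (Metric.thickening_subset_cthickening _ _ h')
    simp [this]
  refine ⟨fun t => ((χ t : ℝ) : ℂ) * g t, hχ.mul g.continuous, hsupp.mul_right, fun t => ?_⟩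
  have hχ1 : (χ t : ℝ) ≤ 1 := by exact_mod_cast thickenedIndicator_le_one one_pos K t
  by_cases ht : t ∈ K
  · have : χ t = 1 := thickenedIndicator_one one_pos K ht
    simp only [this, NNReal.coe_one, Complex.ofReal_one, one_mul, sub_self, norm_zero]
    positivity
  · have h2 : ‖g t / ((ω t : ℝ) : ℂ)‖ < ε := hKg ht
    rw [norm_div, Complex.norm_real, Real.norm_of_nonneg (NNReal.coe_nonneg _),
      div_lt_iff₀ (NNReal.coe_pos.2 (ω.pos t))] at h2
    have h3 : g t - ((χ t : ℝ) : ℂ) * g t = ((1 - χ t : ℝ) : ℂ) * g t := by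
      push_cast
      ring
    rw [h3, norm_mul, Complex.norm_real, Real.norm_of_nonneg (by linarith)]
    refine le_trans (mul_le_of_le_one_left (norm_nonneg _) ?_) h2.le
    have := NNReal.coe_nonneg (χ t)
    linarith

lemma integrable_comp_div [IsFiniteMeasure κ] (hκ : IsDilationKernel κ C ω₁ ω₂) (g : WC0 ω₂)
    (s : ℝ≥0) : Integrable (fun t => g (s / t)) κ := by
  have hg := g.continuous.measurable
  have hm : Measurable fun t => g (s / t) := by fun_prop
  refine (integrable_mul_of_le (u := fun _ => 1) (w := fun t => ω₂ (s / t))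
    hm.aestronglyMeasurable aestronglyMeasurable_const
    (Filter.Eventually.of_forall fun t => g.norm_apply_le _) ?_).congr
    (Filter.Eventually.of_forall fun t => mul_one _)
  simp only [enorm_one, mul_one]
  exact ne_top_of_le_ne_top (ENNReal.mul_ne_top ENNReal.coe_ne_top ENNReal.coe_ne_top)
    (hκ.lintegral_le s)

/-- After division by ω₁, the image of g is a uniform limit of images of compactly supported
functions. Continuity and vanishing at infinity both pass to the limit. -/
lemma exists_c0 [IsFiniteMeasure κ] (hκ : IsDilationKernel κ C ω₁ ω₂) (g : WC0 ω₂) :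
    ∃ k : WC0 ω₁, (∀ s, k s = ∫ t, g (s / t) ∂κ) ∧ ‖k‖ ≤ C * ‖g‖ := by
  have hω : Continuous fun s => ((ω₁ s : ℝ) : ℂ) :=
    Complex.continuous_ofReal.comp (NNReal.continuous_coe.comp ω₁.continuous_toFun)
  let G : ℝ≥0 → ℂ := fun s => (∫ t, g (s / t) ∂κ) / ((ω₁ s : ℝ) : ℂ)
  have approx : ∀ ε > 0, ∃ k : WC0 ω₁, ∀ s, ‖G s - WC0.divWeight ω₁ k s‖ < ε := by
    intro ε hε
    -- The transform multiplies weighted errors by at most C; dividing by C + 1 covers C = 0 and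
    -- keeps the final bound strict.
    have hδ : 0 < ε / (C + 1) := by positivity
    obtain ⟨F, hF, hc, hle⟩ := g.exists_hasCompactSupport_norm_sub_le hδ
    obtain ⟨k, hk⟩ := WC0.exists_eq_of_hasCompactSupport ω₁ (continuous_integral_div (κ := κ) hF hc)
      (hκ.hasCompactSupport_integral_div hc)
    obtain ⟨F', hF'⟩ := WC0.exists_eq_of_hasCompactSupport ω₂ hF hc
    refine ⟨k, fun s => ?_⟩
    have h1 := hκ.norm_integral_div_le (h := fun t => g t - F t) (s := s) hδ.le
      (Filter.Eventually.of_forall fun t => hle _)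
    have hFi : Integrable (fun t => F (s / t)) κ := by
      simpa only [hF'] using hκ.integrable_comp_div F' s
    rw [integral_sub (hκ.integrable_comp_div g s) hFi, ← hk] at h1
    have h2 : G s - WC0.divWeight ω₁ k s
        = ((∫ t, g (s / t) ∂κ) - k s) / ((ω₁ s : ℝ) : ℂ) := (sub_div _ _ _).symm
    rw [h2, norm_div, Complex.norm_real, Real.norm_of_nonneg (NNReal.coe_nonneg _),
      div_lt_iff₀ (NNReal.coe_pos.2 (ω₁.pos s))]
    refine h1.trans_lt (mul_lt_mul_of_pos_right ?_ (NNReal.coe_pos.2 (ω₁.pos s)))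
    rw [← mul_div_assoc, div_lt_iff₀ (by positivity), mul_comm]
    exact mul_lt_mul_of_pos_left (lt_add_one _) hε
  have hGcont : Continuous G := by
    refine continuous_of_uniform_approx_of_continuous fun U hU => ?_
    obtain ⟨ε, hε, hεU⟩ := Metric.mem_uniformity_dist.1 hU
    obtain ⟨k, hk⟩ := approx ε hε
    exact ⟨WC0.divWeight ω₁ k, (WC0.divWeight ω₁ k).continuous,
      fun s => hεU (by rw [dist_eq_norm]; exact hk s)⟩
  have hGzero : Filter.Tendsto G (Filter.cocompact ℝ≥0) (nhds 0) := by
    rw [Metric.tendsto_nhds]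
    intro ε hε
    obtain ⟨k, hk⟩ := approx (ε / 2) (half_pos hε)
    filter_upwards [Metric.tendsto_nhds.1 (WC0.divWeight ω₁ k).zero_at_infty' (ε / 2)
      (half_pos hε)] with s hs
    rw [dist_zero_right] at hs ⊢
    calc ‖G s‖ = ‖(G s - WC0.divWeight ω₁ k s) + WC0.divWeight ω₁ k s‖ := by rw [sub_add_cancel]
      _ ≤ _ := norm_add_le _ _
      _ < ε / 2 + ε / 2 := add_lt_add (hk s) hs
      _ = ε := add_halves ε
  have hG : ∀ s, G s * ((ω₁ s : ℝ) : ℂ) = ∫ t, g (s / t) ∂κ := fun s =>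
    div_mul_cancel₀ _ (ω₁.ne_zero s)
  let k : WC0 ω₁ := ⟨⟨fun s => ∫ t, g (s / t) ∂κ, by
    simp_rw [← hG]
    exact hGcont.mul hω⟩, hGzero⟩
  refine ⟨k, fun s => rfl, WC0.norm_le (by positivity) fun s => ?_⟩
  exact hκ.norm_integral_div_le (norm_nonneg g)
    (Filter.Eventually.of_forall fun t => g.norm_apply_le _)

/-! ### The extension to `M(ω)` -/

/-- The image is the push-forward of u(s) d(|μ| × κ) under (s,t) ↦ s/t. Fubini computes its pairing
with g as ∫ (∫ g(s/t) dκ(t)) u(s) d|μ|(s), and the basic estimate bounds its norm. -/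
lemma exists_pairM_eq [IsFiniteMeasure κ] (hκ : IsDilationKernel κ C ω₁ ω₂) (μ : WM ω₁) :
    ∃ ν : WM ω₂, (∀ (g : WC0 ω₂) (k : WC0 ω₁), (∀ s, k s = ∫ t, g (s / t) ∂κ) →
      pairM g ν = pairM k μ) ∧ ‖ν‖ ≤ C * ‖μ‖ := by
  obtain ⟨u, hu⟩ := μ.exists_represents_id
  have hfinμ := WM.lintegral_ne_top hu
  have := μ.isFiniteMeasureOnCompacts_tv
  have hμ : ∫⁻ s, ω₁ s * ‖u s‖ₑ ∂μ.toLoc.tv = ENNReal.ofReal ‖μ‖ := by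
    rw [← hu.mENorm_eq]
    exact (ENNReal.ofReal_toReal μ.2.ne).symm
  have hle := hκ.lintegral_prod_le hu.aestronglyMeasurable
  have hfin := ne_top_of_le_ne_top (ENNReal.mul_ne_top ENNReal.coe_ne_top hfinμ) hle
  have hus : AEStronglyMeasurable (fun p : ℝ≥0 × ℝ≥0 => u p.1) (μ.toLoc.tv.prod κ) :=
    hu.aestronglyMeasurable.comp_fst
  have hφ : Measurable fun p : ℝ≥0 × ℝ≥0 => p.1 / p.2 := by fun_prop
  obtain ⟨ν, hν⟩ : ∃ ν : LocMeasure, Represents (μ.toLoc.tv.prod κ) (fun p => p.1 / p.2)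
      (fun p => u p.1) ν := by
    refine exists_represents hφ fun E hE hb => ?_
    obtain ⟨c, hc, hcE⟩ := ω₂.exists_le hb
    -- On the preimage of the bounded set E one has 1 ≤ c⁻¹ ω₂(s/t), so finiteness of the weighted
    -- integral gives integrability of u.
    have h2 := integrable_mul_of_le (G := fun _ => 1) (K := c⁻¹)
      (w := fun p : ℝ≥0 × ℝ≥0 => ω₂ (p.1 / p.2)) aestronglyMeasurable_const
      (hus.restrict (s := (fun p : ℝ≥0 × ℝ≥0 => p.1 / p.2) ⁻¹' E)) ?_
      (ne_top_of_le_ne_top hfin (setLIntegral_le_lintegral _ _))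
    · simp only [one_mul] at h2
      exact h2
    · filter_upwards [ae_restrict_mem (hφ hE)] with p hp
      rw [norm_one, ← div_eq_inv_mul, one_le_div (NNReal.coe_pos.2 hc)]
      exact NNReal.coe_le_coe.2 (hcE _ hp)
  have hνle : mENorm ω₂ ν ≤ ENNReal.ofReal (C * ‖μ‖) := by
    rw [ENNReal.ofReal_mul (NNReal.coe_nonneg C), ENNReal.ofReal_coe_nnreal, ← hμ]
    exact (hν.mENorm_le ω₂).trans hle
  let ν' : WM ω₂ := ⟨ν, hνle.trans_lt ENNReal.ofReal_lt_top⟩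
  have hν' : Represents (μ.toLoc.tv.prod κ) (fun p => p.1 / p.2) (fun p => u p.1) ν'.toLoc := hν
  refine ⟨ν', fun g k hk => ?_, ENNReal.toReal_le_of_le_ofReal (by positivity) hνle⟩
  rw [pairM_eq_integral hν' hfin, pairM_eq_integral hu hfinμ,
    integral_prod _ (hν'.integrable hfin g)]
  refine integral_congr_ae (Filter.Eventually.of_forall fun s => ?_)
  dsimp only [id]
  rw [integral_mul_const, hk]

end IsDilationKernel

/-! ### From ψ to the kernel, and the theorem -/

lemma isHardyCesaro_iff {ψ : ℝ≥0 → ℝ≥0} (hψ : AEMeasurable ψ (leb.restrict (Icc 0 1)))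
    {ω₁ ω₂ : Weight} (U : WL1 ω₁ →L[ℂ] WL1 ω₂) :
    IsHardyCesaro ψ U ↔ ∀ f, IsDilationKernel.DilationEq (dilationKernel ψ) f (U f) := by
  refine forall_congr' fun f => Filter.eventually_congr (Filter.Eventually.of_forall fun x => ?_)
  rw [integrable_dilationKernel_iff hψ fun t => f (t * x), integral_dilationKernel hψ]

end HardyCesaro

end

open HardyCesaro
theorem corollary3p2 (ψ : ℝ≥0 → ℝ≥0) (hψ : AEMeasurable ψ (leb.restrict (Set.Icc 0 1)))
    (ω₁ ω₂ : Weight) (hC : ConditionC ψ ω₁ ω₂) :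
    (∃! U : WL1 ω₁ →L[ℂ] WL1 ω₂, IsHardyCesaro ψ U) ∧
    ∀ U : WL1 ω₁ →L[ℂ] WL1 ω₂, IsHardyCesaro ψ U →
      (∃! S : WLinf ω₂ →L[ℂ] WLinf ω₁, IsAdjointL U S) ∧
      ∀ S : WLinf ω₂ →L[ℂ] WLinf ω₁, IsAdjointL U S →
        (∃! V : WC0 ω₂ →L[ℂ] WC0 ω₁, IsRestrictionC0 S V) ∧
        ∀ V : WC0 ω₂ →L[ℂ] WC0 ω₁, IsRestrictionC0 S V →
          (∃! T : WM ω₁ →L[ℂ] WM ω₂, IsAdjointM V T) ∧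
          ∀ T : WM ω₁ →L[ℂ] WM ω₂, IsAdjointM V T →
            ∀ f : WL1 ω₁, T (WL1.toM f) = WL1.toM (U f) := by
  obtain ⟨C, hκ⟩ := hC.exists_isDilationKernel hψ
  have := hκ.isFiniteMeasure
  refine ⟨?_, fun U hU => ⟨?_, fun S hS => ⟨?_, fun V hV => ⟨?_, fun T hT f => ?_⟩⟩⟩⟩
  · simp only [isHardyCesaro_iff hψ]
    exact existsUnique_clm_of_relation _ C hκ.exists_dilationEq (fun _ _ _ h h' => h.unique h')
      (fun _ _ _ _ h h' => h.add hκ h') fun c _ _ h => h.smul hκ c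
  · rw [isHardyCesaro_iff hψ] at hU
    have h := existsUnique_clm_of_relation
      (fun (h : WLinf ω₂) (k : WLinf ω₁) => ∀ f : WL1 ω₁, pairL f k = pairL (U f) h) C ?_ ?_ ?_ ?_
    · simpa only [IsAdjointL, forall_comm (α := WL1 ω₁)] using h
    · intro h
      obtain ⟨k, hk, hle⟩ := hκ.exists_adjoint h
      exact ⟨k, fun f => hκ.pairL_eq_of_ae_eq (hU f) h hk, hle⟩
    · exact fun h k l hk hl => eq_of_pairL_eq fun f => (hk f).trans (hl f).symm
    · intro h h' k k' hk hk' f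
      rw [pairL_add_right, pairL_add_right, hk, hk']
    · intro c h k hk f
      rw [pairL_smul_right, pairL_smul_right, hk]
  all_goals rw [isHardyCesaro_iff hψ] at hU
  all_goals
    -- S is given only through the pairing; testing against L¹(ω₁) shows that it acts on C₀(ω₂) by
    -- the kernel formula.
    have key : ∀ (g : WC0 ω₂) (k : WC0 ω₁),
        (∀ s, k s = ∫ t, g (s / t) ∂(dilationKernel ψ)) → k.toLinf = S g.toLinf := by
      intro g k hk
      refine eq_of_pairL_eq fun f => ?_
      rw [hS, hκ.pairL_eq_of_ae_eq (hU f)]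
      filter_upwards [k.coeFn_toLinf, hκ.ae_ae_div g.coeFn_toLinf] with s h1 h2
      rw [h1, hk, integral_congr_ae h2]
  · refine existsUnique_clm_of_relation (fun (g : WC0 ω₂) (k : WC0 ω₁) => k.toLinf = S g.toLinf)
      C ?_ ?_ ?_ ?_
    · intro g
      obtain ⟨k, hk, hle⟩ := hκ.exists_c0 g
      exact ⟨k, key g k hk, hle⟩
    · exact fun g k l hk hl => WC0.toLinf_injective (hk.trans hl.symm)
    · intro g g' k k' hk hk'
      rw [WC0.toLinf_add, WC0.toLinf_add, map_add, hk, hk']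
    · intro c g k hk
      rw [WC0.toLinf_smul, WC0.toLinf_smul, map_smul, hk]
  -- Since elements of C₀ are continuous, the formula for V holds at every s, as integration against
  -- an arbitrary μ requires.
  · have hVeq : ∀ (g : WC0 ω₂) (s : ℝ≥0), V g s = ∫ t, g (s / t) ∂(dilationKernel ψ) := by
      intro g s
      obtain ⟨k, hk, -⟩ := hκ.exists_c0 g
      have : V g = k := WC0.toLinf_injective ((hV g).trans (key g k hk).symm)
      rw [this, hk]
    have h := existsUnique_clm_of_relation
      (fun (μ : WM ω₁) (ν : WM ω₂) => ∀ g : WC0 ω₂, pairM g ν = pairM (V g) μ) C ?_ ?_ ?_ ?_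
    · simpa only [IsAdjointM, forall_comm (α := WC0 ω₂)] using h
    · intro μ
      obtain ⟨ν, hν, hle⟩ := hκ.exists_pairM_eq μ
      exact ⟨ν, fun g => hν g _ (hVeq g), hle⟩
    · exact fun μ ν ρ hν hρ => eq_of_pairM_eq fun g => (hν g).trans (hρ g).symm
    · intro μ μ' ν ν' hν hν' g
      rw [pairM_add_right, pairM_add_right, hν, hν']
    · intro c μ ν hν g
      rw [pairM_smul_right, pairM_smul_right, hν]
  -- Both measures are tested against g ∈ C₀(ω₂), and the pairings are moved through V, S and U by
  -- the defining identities.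
  · refine eq_of_pairM_eq fun g => ?_
    rw [hT, pairM_toM, pairM_toM, hV, hS]
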